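/- **Setting.** Let $1\le k\le n$, $r\ge 0$. Let $\sigma\in S_n$ be increasing on $\{1,\dots,k\}$ and on $\{k+1,\dots,n\}$. Let $C=(c_1,\dots,c_n)$ be such that $(c_{\sigma(1)},\dots,c_{\sigma(k)})$ is a unit vector with positive entries and $c_{\sigma(i)}=0$ for $i>k$. Let $\omega_1,\dots,\omega_n$ be nonzero reals. On the leaf $\mathcal M^C_{k,\sigma}\cong\mathbb T_k\times\mathbb R^+$ use the coordinates $\theta_{\sigma(1)},\dots,\theta_{\sigma(k)}$ and $\rho=\rho_{\sigma(k)}$; the other radii are $\rho_{\sigma(j)}=\frac{c_{\sigma(j)}}{c_{\sigma(k)}}\rho$. Put $$\hat E_0=\sum_{j=1}^k \frac{c_{\sigma(j)}}{c_{\sigma(k)}}\,\rho\,\frac{\partial}{\partial\rho_{\sigma(j)}},\qquad \Theta^{\sigma(i)}_0=\frac{\partial}{\partial\theta_{\sigma(i)}},\qquad \Theta_k=\sum_{i=1}^k\omega_{\sigma(i)}\Theta_0^{\sigma(i)} .$$ Consider the parametric leaf-normal form $$\Theta_k+\sum_{j\ge 0}a_j(\mu,C)\rho^{2j}\hat E_0+\sum_{i=1}^k\sum_{j\ge0}b^i_j(\mu,C)\rho^{2j}\Theta_0^{\sigma(i)},$$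 where $a_j(\cdot,C)$, $b^i_j(\cdot,C)$ are formal power series in the parameters $\mu=(\mu_1,\dots,\mu_r)$ with $a_0(0,C)=b^i_0(0,C)=0$. Assume that some $a_j(0,C)$ is nonzero, and let $s=\min\{j: a_j(0,C)\neq0\}$. **Theorem (infinite-level parametric leaf-normal form).** There are formal power series $T,\varphi,\psi_1,\dots,\psi_k$ in $(\mu,\rho^2)$ without constant term such that the time rescaling $v\mapsto(1+T(\mu,\rho^2))v$ followed by the near-identity change of state variables $$\rho_{\sigma(j)}=\tfrac{c_{\sigma(j)}}{c_{\sigma(k)}}\,\tilde\rho\,(1+\varphi(\mu,\tilde\rho^2)),\qquad \theta_{\sigma(j)}=\tilde\theta_{\sigma(j)}+\psi_j(\mu,\tilde\rho^2)\qquad(\tilde\rho=\tilde\rho_{\sigma(k)})$$ transforms this field into (dropping tildes) $$\Theta_k+w^{(\infty)},\qquad w^{(\infty)}=\sum_{j=0}^s\hat a_j(\mu,C)\rho^{2j}\hat E_0+\sum_{i=1}^k\sum_{j=0}^s\hat b^i_j(\mu,C)\rho^{2j}\Theta_0^{\sigma(i)},$$ with $\hat a_j,\hat b^i_j$ formal power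 series in $\mu$ such that * $\hat a_j(0,C)=0$ and $\hat b^1_j(\mu,C)=0$ for $0\le j\le s-1$; * $\hat b^i_0(0,C)=0$ for $1\le i\le k$; * $\hat a_s(\mu,C)=a_s(0,C)\neq 0$, independent of $\mu$. Moreover, $v:=\Theta_k+w^{(\infty)}$ is an infinite-level normal form in the following sense. Let $\mathscr L$ be the space of fields $h\hat E_0+\sum_i q_i\Theta_0^{\sigma(i)}$, where $h,q_i$ are formal power series in $(\mu,\rho^2)$, with bracket $[Y,v]=(DY)v-(Dv)Y$. Let $\mathscr R$ be the space of formal power series in $(\mu,\rho^2)$, acting on $\mathscr L$ by multiplication. Give $\mu^{\mathbf m}\rho^{2j}\in\mathscr R$ and $\mu^{\mathbf m}\rho^{2j}\hat E_0$ grade $|\mathbf m|(s+1)+j$, and $\mu^{\mathbf m}\rho^{2j}\Theta_0^{\sigma(i)}$ grade $|\mathbf m|(s+1)+s+j$. Let $\mathscr R_i,\mathscr L_i$ be the homogeneous subspaces and $v_l$ the homogeneous components of $v$. For $N\ge0$ let $\mathcal I_N$ be the space of all sums $$\sum_{i=1}^N (T_iv_{N-i}+[S_i,v_{N-i}]),\qquad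 (T_i,S_i)\in\mathscr R_i\times\mathscr L_i,$$ such that $\sum_{i=1}^{q}(T_iv_{q-i}+[S_i,v_{q-i}])=0$ for all $1\le q<N$. Let $\mathcal C_N\subseteq\mathscr L_N$ be the span of the grade-$N$ monomials among $\mu^{\mathbf m}\rho^{2j}\hat E_0$ ($j<s$), $\rho^{2s}\hat E_0$, $\Theta_0^{\sigma(1)}$, $\mu^{\mathbf m}\rho^{2s}\Theta_0^{\sigma(1)}$, and $\mu^{\mathbf m}\rho^{2j}\Theta_0^{\sigma(i)}$ ($i\ge2$, $j\le s$). Then for every $N\ge 0$, $\mathscr L_N=\mathcal I_N\oplus\mathcal C_N$ and $v_N\in\mathcal C_N$. -/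

import Mathlib

noncomputable section

namespace LeafNF

/-- Formal power series in the bifurcation parameters `μ = (μ₁, …, μ_r)`. -/
abbrev Param (r : ℕ) : Type := MvPowerSeries (Fin r) ℝ

/-- Formal power series in one variable (either `ρ` or `R = ρ ^ 2`, see each use) whose
coefficients are formal power series in the parameters. -/
abbrev Ser (r : ℕ) : Type := PowerSeries (Param r)

/-- The value at `μ = 0` of a formal power series in the parameters. -/
def atZero {r : ℕ} (a : Param r) : ℝ := MvPowerSeries.constantCoeff a

/-- `f(0, 0)`: the value at `μ = 0` of the constant coefficient. -/
def value00 {r : ℕ} (f : Ser r) : ℝ := atZero (PowerSeries.coeff 0 f)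

/-- For `f = f(μ, R)`, the series `f(μ, ρ ^ 2)` in the variable `ρ`. -/
def inSq {r : ℕ} (f : Ser r) : Ser r := PowerSeries.expand 2 two_ne_zero f

section Cells

/-- The index `σ(i) ∈ {1, …, n}` for `i ∈ {1, …, k}` (indices start at `0` here). -/
def sel {n k : ℕ} (hkn : k ≤ n) (σ : Equiv.Perm (Fin n)) (i : Fin k) : Fin n :=
  σ (Fin.castLE hkn i)

/-- The first index of `{1, …, k}`. -/
def firstIdx {k : ℕ} (hk : 0 < k) : Fin k := ⟨0, hk⟩

/-- The last index of `{1, …, k}`. -/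
def lastIdx {k : ℕ} (hk : 0 < k) : Fin k := ⟨k - 1, Nat.sub_one_lt_of_lt hk⟩

/-- The permutations `S_n^k` labelling the `2k`-cells: `σ` is increasing on the first `k` indices
and increasing on the remaining ones. -/
def cellPerms (n k : ℕ) : Set (Equiv.Perm (Fin n)) :=
  {σ | ∀ i j : Fin n, i < j → ((j : ℕ) < k ∨ k ≤ (i : ℕ)) → σ i < σ j}

/-- The open positive part of the unit sphere labelling the leaves of the cell of `σ`:
`(c_{σ(1)}, …, c_{σ(k)})` is a unit vector with positive entries, the other entries vanish. -/
def leafLabels (n k : ℕ) (σ : Equiv.Perm (Fin n)) : Set (Fin n → ℝ) :=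
  {C | (∑ i, C i ^ 2 = 1) ∧ (∀ i : Fin n, (i : ℕ) < k → 0 < C (σ i)) ∧
    (∀ i : Fin n, k ≤ (i : ℕ) → C (σ i) = 0)}

end Cells

/-! ### Formal vector fields and formal changes of variables on a leaf

On the leaf of `C` the points are given by the angles `θ_{σ(1)}, …, θ_{σ(k)}` and by
`ρ = ρ_{σ(k)} > 0`, the other radii being `ρ_{σ(j)} = (c_{σ(j)} / c_{σ(k)}) ρ`. -/

/-- A formal parametric vector field on the leaf whose components do not depend on the angles:
`∑_j dρ_j(μ, ρ) ∂/∂ρ_{σ(j)} + ∑_j dθ_j(μ, ρ) ∂/∂θ_{σ(j)}`, with `ρ = ρ_{σ(k)}`. -/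
structure FormalField (k r : ℕ) where
  dρ : Fin k → Ser r
  dθ : Fin k → Ser r

/-- A formal parametric change of variables
`ρ_{σ(j)} = rad_j(μ, ρ')`, `θ_{σ(j)} = θ'_{σ(j)} + ang_j(μ, ρ')`, with `ρ' = ρ'_{σ(k)}`. -/
structure FormalChange (k r : ℕ) where
  rad : Fin k → Ser r
  ang : Fin k → Ser r

/-- The algebra of leaf fields in first-level form, with coefficients depending on parameters.
The pair `(h, q)` of series in `R` stands for `h(μ, ρ²) Ê₀ + ∑_i q_i(μ, ρ²) ∂/∂θ_{σ(i)}`, where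
`Ê₀ = ∑_j (c_{σ(j)} / c_{σ(k)}) ρ ∂/∂ρ_{σ(j)}` (see `toField`). -/
abbrev LeafAlg (k r : ℕ) : Type := Ser r × (Fin k → Ser r)

/-- The ratio `c_{σ(j)} / c_{σ(k)}`, as a constant series. -/
def ratio {n k : ℕ} (r : ℕ) (hk : 0 < k) (hkn : k ≤ n) (σ : Equiv.Perm (Fin n)) (C : Fin n → ℝ)
    (j : Fin k) : Ser r :=
  PowerSeries.C (MvPowerSeries.C (C (sel hkn σ j) / C (sel hkn σ (lastIdx hk))))

/-- The vector field on the leaf of `C` that an element `(h, q)` of `LeafAlg` stands for. -/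
def toField {n k r : ℕ} (hk : 0 < k) (hkn : k ≤ n) (σ : Equiv.Perm (Fin n)) (C : Fin n → ℝ)
    (u : LeafAlg k r) : FormalField k r where
  dρ j := ratio r hk hkn σ C j * PowerSeries.X * inSq u.1
  dθ i := inSq (u.2 i)

/-- The change of state variables
`ρ_{σ(j)} = (c_{σ(j)} / c_{σ(k)}) ρ' (1 + φ(μ, ρ'²))`, `θ_{σ(j)} = θ'_{σ(j)} + ψ_j(μ, ρ'²)`.
It maps the leaf of `C` to itself. -/
def leafChange {n k r : ℕ} (hk : 0 < k) (hkn : k ≤ n) (σ : Equiv.Perm (Fin n)) (C : Fin n → ℝ)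
    (φ : Ser r) (ψ : Fin k → Ser r) : FormalChange k r where
  rad j := ratio r hk hkn σ C j * PowerSeries.X * (1 + inSq φ)
  ang i := inSq (ψ i)

/-- Time rescaling: the field `v + T v`, with `T = T(μ, ρ²)`. -/
def timeRescale {k r : ℕ} (T : Ser r) (v : FormalField k r) : FormalField k r where
  dρ j := (1 + inSq T) * v.dρ j
  dθ i := (1 + inSq T) * v.dθ i

/-- `w` is the field `v` written in the new variables: `DΦ · w = v ∘ Φ`, where the derivative is
taken along the leaf, in the coordinates `(θ', ρ')` with `ρ' = ρ'_{σ(k)}`. -/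
def Transforms {k r : ℕ} (hk : 0 < k) (Φ : FormalChange k r) (v w : FormalField k r) : Prop :=
  (∀ j, PowerSeries.derivative (Param r) (Φ.rad j) * w.dρ (lastIdx hk) =
      PowerSeries.subst (Φ.rad (lastIdx hk)) (v.dρ j)) ∧
  (∀ i, w.dθ i + PowerSeries.derivative (Param r) (Φ.ang i) * w.dρ (lastIdx hk) =
      PowerSeries.subst (Φ.rad (lastIdx hk)) (v.dθ i))

/-- `Θ_k + ∑_j a_j(μ) ρ^{2j} Ê₀ + ∑_i ∑_j b^i_j(μ) ρ^{2j} ∂/∂θ_{σ(i)}` with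
`Θ_k = ∑_i ω_{σ(i)} ∂/∂θ_{σ(i)}`. -/
def parametricField {n k r : ℕ} (hkn : k ≤ n) (σ : Equiv.Perm (Fin n)) (ω : Fin n → ℝ)
    (a : ℕ → Param r) (b : Fin k → ℕ → Param r) : LeafAlg k r :=
  (PowerSeries.mk a,
    fun i => PowerSeries.C (MvPowerSeries.C (ω (sel hkn σ i))) + PowerSeries.mk (b i))

/-- The same with the sums over `j` restricted to `j ≤ s`. -/
def finiteField {n k r : ℕ} (hkn : k ≤ n) (σ : Equiv.Perm (Fin n)) (ω : Fin n → ℝ) (s : ℕ)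
    (a : ℕ → Param r) (b : Fin k → ℕ → Param r) : LeafAlg k r :=
  (∑ j ∈ Finset.range (s + 1), PowerSeries.C (a j) * PowerSeries.X ^ j,
    fun i => PowerSeries.C (MvPowerSeries.C (ω (sel hkn σ i))) +
      ∑ j ∈ Finset.range (s + 1), PowerSeries.C (b i j) * PowerSeries.X ^ j)

/-! ### Grading, bracket and normal form levels -/

/-- The derivation `ρ ∂/∂ρ = 2 R ∂/∂R` on series in `R = ρ²`. -/
def euler {r : ℕ} (f : Ser r) : Ser r := 2 * PowerSeries.X * PowerSeries.derivative (Param r) f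

lemma euler_add {r : ℕ} (f g : Ser r) : euler (f + g) = euler f + euler g := by
  simp [euler, mul_add]

lemma euler_smul {r : ℕ} (c : ℝ) (f : Ser r) : euler (c • f) = c • euler f := by
  have h : PowerSeries.derivative (Param r) (c • f) =
      c • PowerSeries.derivative (Param r) f := by
    ext n m
    simp [PowerSeries.coeff_derivative]
  simp [euler, h]

/-- The bracket `[Y, v] = (DY) v - (Dv) Y` of `Y = p Ê₀ + ∑ h_i ∂/∂θ_{σ(i)}` and
`v = h Ê₀ + ∑ q_i ∂/∂θ_{σ(i)}`. -/
def bracket {k r : ℕ} (Y v : LeafAlg k r) : LeafAlg k r :=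
  (euler Y.1 * v.1 - euler v.1 * Y.1, fun i => euler (Y.2 i) * v.1 - euler (v.2 i) * Y.1)

/-- Pairs `(T, S)` of a time rescaling generator and a state transformation generator. -/
abbrev Gen (k r : ℕ) : Type := Ser r × LeafAlg k r

/-- The map `(T, S) ↦ T v + [S, v]`. -/
def act {k r : ℕ} (v : LeafAlg k r) : Gen k r →ₗ[ℝ] LeafAlg k r where
  toFun X := X.1 • v + bracket X.2 v
  map_add' X Y := by
    refine Prod.ext ?_ (funext fun i => ?_)
    · simp [bracket, euler_add]; ring
    · simp [bracket, euler_add]; ring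
  map_smul' c X := by
    refine Prod.ext ?_ (funext fun i => ?_)
    · simp [bracket, euler_smul, smul_sub, smul_add]
    · simp [bracket, euler_smul, smul_sub, smul_add]

/-- The weight `|m| (s + 1) + d + j` of the monomial `μ^m R^j`; `d = 0` for time rescaling
generators and Eulerian terms, `d = s` for rotational terms. -/
def weight {r : ℕ} (s d : ℕ) (m : Fin r →₀ ℕ) (j : ℕ) : ℕ := m.degree * (s + 1) + d + j

/-- The coefficient of `μ^m R^j`. -/
def cf {r : ℕ} (m : Fin r →₀ ℕ) (j : ℕ) (f : Ser r) : ℝ :=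
  MvPowerSeries.coeff m (PowerSeries.coeff j f)

/-- The part of a series consisting of its monomials of weight `n`. -/
def serPart {r : ℕ} (s d n : ℕ) (f : Ser r) : Ser r :=
  PowerSeries.mk fun j => (fun m => if weight s d m j = n then cf m j f else 0 : Param r)

/-- The component `v_n` of grade `n` of a leaf field. -/
def part {k r : ℕ} (s n : ℕ) (v : LeafAlg k r) : LeafAlg k r :=
  (serPart s 0 n v.1, fun i => serPart s s n (v.2 i))

/-- The series all of whose monomials satisfy `P`. -/
def supportedSer {r : ℕ} (P : (Fin r →₀ ℕ) → ℕ → Prop) : Submodule ℝ (Ser r) where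
  carrier := {f | ∀ m j, ¬ P m j → cf m j f = 0}
  zero_mem' := by simp [cf]
  add_mem' := by
    intro f g hf hg m j h
    have h1 := hf m j h
    have h2 := hg m j h
    simp only [cf] at h1 h2 ⊢
    simp [h1, h2]
  smul_mem' := by
    intro c f hf m j h
    have h1 := hf m j h
    simp only [cf] at h1 ⊢
    simp [h1]

/-- The leaf fields whose Eulerian monomials satisfy `P` and whose rotational monomials in
the direction `∂/∂θ_{σ(i)}` satisfy `Q i`. -/
def supportedFields {k r : ℕ} (P : (Fin r →₀ ℕ) → ℕ → Prop)
    (Q : Fin k → (Fin r →₀ ℕ) → ℕ → Prop) : Submodule ℝ (LeafAlg k r) :=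
  (supportedSer P).prod (Submodule.pi Set.univ fun i => supportedSer (Q i))

/-- The space of leaf fields that are homogeneous of grade `n`. -/
def homFields (k r s n : ℕ) : Submodule ℝ (LeafAlg k r) :=
  supportedFields (fun m j => weight s 0 m j = n) (fun _ m j => weight s s m j = n)

/-- The space of generators `(T, S)` that are homogeneous of grade `n`. -/
def homGens (k r s n : ℕ) : Submodule ℝ (Gen k r) :=
  (supportedSer fun m j => weight s 0 m j = n).prod (homFields k r s n)

/-- For a sequence `X_i = (T_i, S_i)`, the grade `n` sum `∑_{i + l = n} (T_i v_l + [S_i, v_l])`. -/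
def dMap {k r : ℕ} (s : ℕ) (v : LeafAlg k r) (n : ℕ) :
    (ℕ → Gen k r) →ₗ[ℝ] LeafAlg k r :=
  ∑ p ∈ Finset.HasAntidiagonal.antidiagonal n, (act (part s p.2 v)).comp (LinearMap.proj p.1)

/-- The domain of the level-`l` map in grade `n`: homogeneous generators
`X_{n-l+1}, …, X_n` (the others are zero) for which the sums of all grades below `n` vanish. -/
def levelDomain {k r : ℕ} (s : ℕ) (v : LeafAlg k r) (n l : ℕ) : Submodule ℝ (ℕ → Gen k r) where
  carrier := {X | (∀ i, X i ∈ homGens k r s i) ∧ (∀ i, i + l ≤ n → X i = 0) ∧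
    ∀ q < n, dMap s v q X = 0}
  zero_mem' := ⟨fun _ => Submodule.zero_mem _, fun _ _ => rfl, fun _ _ => map_zero _⟩
  add_mem' := by
    rintro X Y ⟨h1, h2, h3⟩ ⟨g1, g2, g3⟩
    refine ⟨fun i => Submodule.add_mem _ (h1 i) (g1 i), fun i hi => ?_, fun q hq => ?_⟩
    · simp [h2 i hi, g2 i hi]
    · rw [map_add, h3 q hq, g3 q hq, add_zero]
  smul_mem' := by
    rintro c X ⟨h1, h2, h3⟩
    refine ⟨fun i => Submodule.smul_mem _ c (h1 i), fun i hi => ?_, fun q hq => ?_⟩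
    · simp [h2 i hi]
    · rw [map_smul, h3 q hq, smul_zero]

/-- The space of terms of grade `n` that can be removed from `v` at level `l`. -/
def levelImage {k r : ℕ} (s : ℕ) (v : LeafAlg k r) (n l : ℕ) : Submodule ℝ (LeafAlg k r) :=
  (levelDomain s v n l).map (dMap s v n)

/-- `v` is an infinite-level normal form in the style `𝒞`: in each grade `n`, the space `𝒞 n` is a
complement, in the fields of grade `n`, of the space of terms that can be removed
using generators of all positive grades `1, …, n`, and the component `v_n` lies in `𝒞 n`. -/
def IsInfiniteLevel {k r : ℕ} (s : ℕ) (𝒞 : ℕ → Submodule ℝ (LeafAlg k r))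
    (v : LeafAlg k r) : Prop :=
  ∀ n, levelImage s v n n ⊓ 𝒞 n = ⊥ ∧ levelImage s v n n ⊔ 𝒞 n = homFields k r s n ∧
    part s n v ∈ 𝒞 n

/-- The grade `n` fields spanned by the monomials
`μ^m ρ^{2j} Ê₀` with `j < s`; `ρ^{2s} Ê₀`; `∂/∂θ_{σ(1)}` and `μ^m ρ^{2s} ∂/∂θ_{σ(1)}`;
`μ^m ρ^{2j} ∂/∂θ_{σ(i)}` with `i ≥ 2` and `j ≤ s`. -/
def remainingTerms {k : ℕ} (r : ℕ) (hk : 0 < k) (s n : ℕ) : Submodule ℝ (LeafAlg k r) :=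
  homFields k r s n ⊓
    supportedFields (fun m j => j < s ∨ (j = s ∧ m = 0))
      (fun i m j => if i = firstIdx hk then j = s ∨ (j = 0 ∧ m = 0) else j ≤ s)

end LeafNF

end

open LeafNF

/-!
With `R = ρ²`, a leaf field is a pair `(h, q)` of a series `h` in `(μ, R)` and a vector `q` of such
series. It generates `ρ' = ρ h`, `θ_i' = q_i`, and the change `ρ ↦ ρ (1 + φ)` acts on series by
`f ↦ f(μ, R (1 + φ)²)` (`comp`, `transforms_of_comp`). All estimates are relative to the weight
`|m| (s + 1) + j` of `μ^m R^j`, for which the leading parts of `h` and `q_i` are the monomial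
`a_s(0) R^s` and the constant `ω_i`.

*Existence.* Dividing the field by its first frequency `q_1` leaves a parametric field `R' = 2 R H`
on the line, and a near-identity change of `R` turns `H` into a polynomial of degree `s` in `R`
divided by `ω_1 + β R^s`, with `β` the residue (`exists_radial_normalForm`). To leading order this
is the homological equation `a R^s (ρ ∂φ/∂ρ - 2 s φ) + α - (a / ω_1) β R^{2s} = y`, which is
solvable with a right inverse that respects weights: `α` takes the powers below `s`, `β` the
resonant power `2 s`. Writing all unknowns in terms of `y`, the remaining terms form a contraction
for the weight filtration, and the contraction principle `exists_fixedPoint` gives a solution.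
The time rescaling is then chosen so that the first frequency becomes exactly `ω_1 + β R^s`, and
the other frequencies are reduced to degree `s` by Weierstrass division by `R h` through the shifts
`ψ_i` of the angles (`exists_division`).

*Uniqueness of the level.* The lowest component of the normalised field `v` is
`v_s = a R^s Ê₀ + ∑ ω_i ∂/∂θ_i`. The kernel of `(T, S) ↦ T v_s + [S, v_s]` consists of the pairs
`(-(ρ ∂f/∂ρ) h_s, f v_s)`, up to rotations constant along `ρ`
(`exists_multiplier_of_act_lead_eq_zero`). Such a pair is the leading term of
`(-(ρ ∂f/∂ρ) h, f v)`, which acts trivially on the whole of `v`: moving along the orbits of `v` is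
undone by a time rescaling. In components this is an antisymmetry (`dMap_trivialGen`). So no
cancellation of lower grades produces new removable terms, and the removable terms of grade
`d + s` are exactly the image of the grade `d` generators under the leading operator
(`levelImage_eq_map`), for which `remainingTerms` is a complement by comparison of coefficients.
-/

namespace LeafNF

variable {r : ℕ}

/-! ### Coefficients and the weight filtration -/

lemma ext_cf {f g : Ser r} (h : ∀ m j, cf m j f = cf m j g) : f = g := by
  ext j m
  exact h m j

@[simp] lemma cf_zero (m : Fin r →₀ ℕ) (j : ℕ) : cf m j (0 : Ser r) = 0 := by simp [cf]

@[simp] lemma cf_add (m : Fin r →₀ ℕ) (j : ℕ) (f g : Ser r) :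
    cf m j (f + g) = cf m j f + cf m j g := by simp [cf]

@[simp] lemma cf_sub (m : Fin r →₀ ℕ) (j : ℕ) (f g : Ser r) :
    cf m j (f - g) = cf m j f - cf m j g := by simp [cf]

@[simp] lemma cf_neg (m : Fin r →₀ ℕ) (j : ℕ) (f : Ser r) :
    cf m j (-f) = -cf m j f := by simp [cf]

lemma cf_mul (m : Fin r →₀ ℕ) (j : ℕ) (f g : Ser r) :
    cf m j (f * g) = ∑ p ∈ Finset.HasAntidiagonal.antidiagonal j,
      ∑ q ∈ Finset.HasAntidiagonal.antidiagonal m, cf q.1 p.1 f * cf q.2 p.2 g := by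
  simp [cf, PowerSeries.coeff_mul, MvPowerSeries.coeff_mul]

lemma cf_X_pow_mul (m : Fin r →₀ ℕ) (j d : ℕ) (f : Ser r) :
    cf m j (PowerSeries.X ^ d * f) = if d ≤ j then cf m (j - d) f else 0 := by
  unfold cf
  rw [PowerSeries.coeff_X_pow_mul']
  split_ifs <;> simp

/-- The series with prescribed coefficients. -/
noncomputable def ofCf (c : (Fin r →₀ ℕ) → ℕ → ℝ) : Ser r :=
  PowerSeries.mk fun j => (fun m => c m j : Param r)

@[simp] lemma cf_ofCf (m : Fin r →₀ ℕ) (j : ℕ) (c : (Fin r →₀ ℕ) → ℕ → ℝ) :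
    cf m j (ofCf c) = c m j := by
  unfold cf ofCf
  erw [PowerSeries.coeff_mk]

/-- The constant series with value `x`. -/
noncomputable def cst (x : ℝ) : Ser r := PowerSeries.C (MvPowerSeries.C x)

@[simp] lemma cf_cst_mul (m : Fin r →₀ ℕ) (j : ℕ) (x : ℝ) (f : Ser r) :
    cf m j (cst x * f) = x * cf m j f := by
  simp [cf, cst]

lemma cf_cst (m : Fin r →₀ ℕ) (j : ℕ) (x : ℝ) :
    cf m j (cst x : Ser r) = if m = 0 ∧ j = 0 then x else 0 := by
  unfold cf cst
  rw [PowerSeries.coeff_C]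
  by_cases hj : j = 0
  · simp [hj, MvPowerSeries.coeff_C]
  · simp [hj]

lemma cst_mul_cst (x y : ℝ) : (cst x * cst y : Ser r) = cst (x * y) := by
  simp [cst]

@[simp] lemma cst_one : (cst 1 : Ser r) = 1 := by simp [cst]

@[simp] lemma cf_euler (m : Fin r →₀ ℕ) (j : ℕ) (f : Ser r) :
    cf m j (euler f) = 2 * j * cf m j f := by
  have h : euler f = cst 2 * (PowerSeries.X ^ 1 * PowerSeries.derivative (Param r) f) := by
    have e : (cst 2 : Ser r) = 2 := by
      rw [cst, map_ofNat, map_ofNat]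
    rw [e, euler, pow_one, mul_assoc]
  rw [h, cf_cst_mul, cf_X_pow_mul]
  rcases j with _ | j
  · simp
  · have e : ((j : Param r) + 1) = MvPowerSeries.C ((j : ℝ) + 1) := by simp
    simp only [cf, Nat.le_add_left, if_true, Nat.add_sub_cancel, PowerSeries.coeff_derivative]
    rw [e, MvPowerSeries.coeff_mul_C]
    push_cast
    ring

lemma euler_zero : euler (0 : Ser r) = 0 := by simp [euler]

lemma euler_sub (f g : Ser r) : euler (f - g) = euler f - euler g := by
  simp [euler, mul_sub]

lemma euler_mul (f g : Ser r) : euler (f * g) = euler f * g + f * euler g := by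
  simp only [euler, Derivation.leibniz, smul_eq_mul]
  ring

/-- The operator `R^{j+d} ↦ c_j R^j`, which kills the powers of `R` below `d`. -/
noncomputable def shiftScale (d : ℕ) (c : ℕ → ℝ) (f : Ser r) : Ser r :=
  PowerSeries.mk fun j => MvPowerSeries.C (c j) * PowerSeries.coeff (j + d) f

@[simp] lemma cf_shiftScale (m : Fin r →₀ ℕ) (j d : ℕ) (c : ℕ → ℝ) (f : Ser r) :
    cf m j (shiftScale d c f) = c j * cf m (j + d) f := by
  simp [cf, shiftScale]

lemma shiftScale_sub (d : ℕ) (c : ℕ → ℝ) (f g : Ser r) :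
    shiftScale d c (f - g) = shiftScale d c f - shiftScale d c g :=
  ext_cf fun m j => by simp [mul_sub]

lemma mul_mem_supportedSer {P Q S : (Fin r →₀ ℕ) → ℕ → Prop} {f g : Ser r}
    (hf : f ∈ supportedSer P) (hg : g ∈ supportedSer Q)
    (h : ∀ m i m' j, P m i → Q m' j → S (m + m') (i + j)) : f * g ∈ supportedSer S := by
  intro m j hS
  rw [cf_mul]
  refine Finset.sum_eq_zero fun p hp => Finset.sum_eq_zero fun q hq => ?_
  rw [Finset.HasAntidiagonal.mem_antidiagonal] at hp hq
  by_cases h1 : P q.1 p.1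
  · by_cases h2 : Q q.2 p.2
    · exact absurd (hq ▸ hp ▸ h _ _ _ _ h1 h2) hS
    · rw [hg _ _ h2, mul_zero]
  · rw [hf _ _ h1, zero_mul]

lemma euler_mem_supportedSer {P : (Fin r →₀ ℕ) → ℕ → Prop} {f : Ser r}
    (hf : f ∈ supportedSer P) : euler f ∈ supportedSer P := fun m j h => by
  rw [cf_euler, hf m j h, mul_zero]

lemma weight_add (s d e : ℕ) (m m' : Fin r →₀ ℕ) (i j : ℕ) :
    weight s (d + e) (m + m') (i + j) = weight s d m i + weight s e m' j := by
  simp only [weight, map_add]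
  ring

/-- The series all of whose monomials `μ^m R^j` have weight `|m| (s + 1) + j` at least `n`. -/
def filt (r s n : ℕ) : Submodule ℝ (Ser r) := supportedSer fun m j => n ≤ weight s 0 m j

lemma mem_filt {s n : ℕ} {f : Ser r} :
    f ∈ filt r s n ↔ ∀ m j, weight s 0 m j < n → cf m j f = 0 := by
  simp [filt, supportedSer]

lemma filt_anti {s n n' : ℕ} (h : n ≤ n') {f : Ser r} (hf : f ∈ filt r s n') : f ∈ filt r s n :=
  mem_filt.2 fun m j hm => mem_filt.1 hf m j (hm.trans_le h)

lemma mem_filt_zero (s : ℕ) (f : Ser r) : f ∈ filt r s 0 :=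
  mem_filt.2 fun _ _ h => absurd h (Nat.not_lt_zero _)

lemma mul_mem_filt {s n n' : ℕ} {f g : Ser r} (hf : f ∈ filt r s n) (hg : g ∈ filt r s n') :
    f * g ∈ filt r s (n + n') :=
  mul_mem_supportedSer hf hg fun m i m' j h1 h2 => by
    have : weight s 0 (m + m') (i + j) = _ := weight_add s 0 0 m m' i j
    omega

lemma mul_mem_filt_left {s n : ℕ} {f g : Ser r} (hf : f ∈ filt r s n) : f * g ∈ filt r s n := by
  simpa using mul_mem_filt hf (mem_filt_zero s g)

lemma mul_mem_filt_right {s n : ℕ} {f g : Ser r} (hg : g ∈ filt r s n) : f * g ∈ filt r s n := by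
  simpa using mul_mem_filt (mem_filt_zero s f) hg

lemma X_pow_mem_filt (s d : ℕ) : (PowerSeries.X ^ d : Ser r) ∈ filt r s d :=
  mem_filt.2 fun m j h => by
    have hj : j < d := by unfold weight at h; omega
    rw [← mul_one (PowerSeries.X ^ d : Ser r), cf_X_pow_mul, if_neg hj.not_ge]

lemma shiftScale_mem_filt {s n : ℕ} (d : ℕ) (c : ℕ → ℝ) {f : Ser r}
    (hf : f ∈ filt r s (n + d)) : shiftScale d c f ∈ filt r s n :=
  mem_filt.2 fun m j h => by
    rw [cf_shiftScale, mem_filt.1 hf m (j + d) (by unfold weight at *; omega), mul_zero]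

/-- `u` and `v` have order at least `p` and agree to relative precision `d`. A map preserving the
order which increases `d` is a contraction for the topology of the weight filtration. -/
def Close (s d p : ℕ) (u v : Ser r) : Prop :=
  u ∈ filt r s p ∧ v ∈ filt r s p ∧ u - v ∈ filt r s (p + d)

namespace Close

variable {s d p q : ℕ} {u u' v v' : Ser r}

lemma refl (d : ℕ) (h : u ∈ filt r s p) : Close s d p u u :=
  ⟨h, h, by simp⟩

lemma const (d : ℕ) (u : Ser r) : Close s d 0 u u := refl d (mem_filt_zero s u)

lemma add (h : Close s d p u v) (h' : Close s d p u' v') : Close s d p (u + u') (v + v') :=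
  ⟨add_mem h.1 h'.1, add_mem h.2.1 h'.2.1, by
    have := add_mem h.2.2 h'.2.2
    rwa [show u + u' - (v + v') = u - v + (u' - v') by ring]⟩

lemma sub (h : Close s d p u v) (h' : Close s d p u' v') : Close s d p (u - u') (v - v') :=
  ⟨sub_mem h.1 h'.1, sub_mem h.2.1 h'.2.1, by
    have := sub_mem h.2.2 h'.2.2
    rwa [show u - u' - (v - v') = u - v - (u' - v') by ring]⟩

lemma mul (h : Close s d p u v) (h' : Close s d q u' v') : Close s d (p + q) (u * u') (v * v') :=
  ⟨mul_mem_filt h.1 h'.1, mul_mem_filt h.2.1 h'.2.1, by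
    have h1 := mul_mem_filt h.2.2 h'.1
    have h2 := mul_mem_filt h.2.1 h'.2.2
    have e : u * u' - v * v' = (u - v) * u' + v * (u' - v') := by ring
    rw [e]
    exact add_mem (filt_anti (by omega) h1) (filt_anti (by omega) h2)⟩

/-- Order can be traded for relative precision. -/
lemma trade {e : ℕ} (h : Close s d p u v) (hq : q ≤ p) (he : q + e ≤ p + d) : Close s e q u v :=
  ⟨filt_anti hq h.1, filt_anti hq h.2.1, filt_anti he h.2.2⟩

lemma pow (h : Close s d 0 u v) (n : ℕ) : Close s d 0 (u ^ n) (v ^ n) := by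
  induction n with
  | zero => simpa using const d 1
  | succ n ih => simpa [pow_succ] using ih.mul h

lemma euler (h : Close s d p u v) : Close s d p (euler u) (LeafNF.euler v) :=
  ⟨euler_mem_supportedSer h.1, euler_mem_supportedSer h.2.1, by
    rw [← euler_sub]
    exact euler_mem_supportedSer h.2.2⟩

lemma shiftScale {e : ℕ} (c : ℕ → ℝ) (h : Close s d (p + e) u v) :
    Close s d p (shiftScale e c u) (LeafNF.shiftScale e c v) :=
  ⟨shiftScale_mem_filt e c h.1, shiftScale_mem_filt e c h.2.1, by
    rw [← shiftScale_sub]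
    exact shiftScale_mem_filt e c (by rw [add_right_comm]; exact h.2.2)⟩

lemma one_add (h : Close s d 1 u v) : Close s (d + 1) 0 (1 + u) (1 + v) :=
  (const _ 1).add (h.trade (Nat.zero_le _) (by omega))

lemma one_add_pow_sub_one (h : Close s d 1 u v) (n : ℕ) :
    Close s d 1 ((1 + u) ^ n - 1) ((1 + v) ^ n - 1) := by
  induction n with
  | zero => simpa using refl d (zero_mem (filt r s 1))
  | succ n ih =>
    have e : ∀ w : Ser r, (1 + w) ^ (n + 1) - 1 = (1 + w) * ((1 + w) ^ n - 1) + w := fun w => by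
      ring
    have h1 : Close s d 0 (1 + u) (1 + v) := h.one_add.trade le_rfl (by omega)
    have := (h1.mul ih).add (by simpa using h)
    rw [e, e]
    simpa using this

/-- The nonlinear part of `(1 + u) ^ n` is quadratic in `u`. -/
lemma one_add_pow_sub_linear (h : Close s d 1 u v) (n : ℕ) :
    Close s d 2 ((1 + u) ^ n - 1 - (n : Ser r) * u) ((1 + v) ^ n - 1 - (n : Ser r) * v) := by
  induction n with
  | zero => simpa using refl d (zero_mem (filt r s 2))
  | succ n ih =>
    have e : ∀ w : Ser r, (1 + w) ^ (n + 1) - 1 - ((n + 1 : ℕ) : Ser r) * w =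
        ((1 + w) ^ n - 1 - (n : Ser r) * w) + w * ((1 + w) ^ n - 1) := fun w => by
      push_cast
      ring
    rw [e, e]
    exact ih.add (h.mul (h.one_add_pow_sub_one n))

lemma sum {ι : Type*} {t : Finset ι} {f g : ι → Ser r} (h : ∀ i ∈ t, Close s d p (f i) (g i)) :
    Close s d p (∑ i ∈ t, f i) (∑ i ∈ t, g i) :=
  ⟨Submodule.sum_mem _ fun i hi => (h i hi).1, Submodule.sum_mem _ fun i hi => (h i hi).2.1, by
    rw [← Finset.sum_sub_distrib]
    exact Submodule.sum_mem _ fun i hi => (h i hi).2.2⟩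

end Close

/-- Contraction principle: the iterates of `0` stabilise coefficientwise to a fixed point. -/
lemma exists_fixedPoint {s b : ℕ} (Φ : Ser r → Ser r)
    (hΦ : ∀ d y z, Close s d b y z → Close s (d + 1) b (Φ y) (Φ z)) :
    ∃ y ∈ filt r s b, Φ y = y := by
  have hmem : ∀ y ∈ filt r s b, Φ y ∈ filt r s b := fun y hy => (hΦ 0 y y (Close.refl 0 hy)).1
  let x : ℕ → Ser r := fun n => Φ^[n] 0
  have hx : ∀ n, x n ∈ filt r s b := by
    intro n
    induction n with
    | zero => exact zero_mem _
    | succ n ih => simpa only [x, Function.iterate_succ_apply'] using hmem _ ih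
  have hstep : ∀ n, Close s n b (x n) (x (n + 1)) := by
    intro n
    induction n with
    | zero => exact ⟨hx 0, hx 1, sub_mem (hx 0) (hx 1)⟩
    | succ n ih => simpa only [x, Function.iterate_succ_apply'] using hΦ _ _ _ ih
  have hcauchy : ∀ n k, x n - x (n + k) ∈ filt r s (b + n) := by
    intro n k
    induction k with
    | zero => simp
    | succ k ih =>
      have := add_mem ih (filt_anti (by omega) (hstep (n + k)).2.2)
      simpa [add_assoc] using this
  let y : Ser r := ofCf fun m j => cf m j (x (weight s 0 m j + 1))
  have hcf : ∀ m j, cf m j y = cf m j (x (weight s 0 m j + 1)) := fun m j => cf_ofCf m j _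
  have hlim : ∀ n, Close s n b y (x n) := by
    intro n
    refine ⟨mem_filt.2 fun m j h => ?_, hx n, mem_filt.2 fun m j h => ?_⟩
    · rw [hcf]
      exact mem_filt.1 (hx _) m j h
    · rw [cf_sub, hcf]
      rcases le_total n (weight s 0 m j + 1) with hn | hn
      · obtain ⟨k, hk⟩ := Nat.exists_eq_add_of_le hn
        have := mem_filt.1 (hcauchy n k) m j h
        rw [cf_sub] at this
        rw [hk]
        linarith
      · obtain ⟨k, hk⟩ := Nat.exists_eq_add_of_le hn
        have := mem_filt.1 (hcauchy (weight s 0 m j + 1) k) m j (by omega)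
        rwa [cf_sub, ← hk] at this
  refine ⟨y, (hlim 0).1, ext_cf fun m j => ?_⟩
  have h1 := (hΦ _ _ _ (hlim (weight s 0 m j))).2.2
  have h2 := (hlim (weight s 0 m j + 1)).2.2
  have e : Φ (x (weight s 0 m j)) = x (weight s 0 m j + 1) := by
    simp only [x, Function.iterate_succ_apply']
  rw [e] at h1
  have := mem_filt.1 (sub_mem h1 h2) m j (by omega)
  simp only [cf_sub] at this
  linarith

/-! ### Composition with a near-identity radial change -/

/-- `f(μ, R (1 + φ)²)`: the effect of `ρ ↦ ρ (1 + φ(μ, ρ²))` on a series in `R = ρ²`. -/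
noncomputable def comp (φ f : Ser r) : Ser r :=
  PowerSeries.subst (PowerSeries.X * (1 + φ) ^ 2 : Ser r) f

lemma hasSubst_change (φ : Ser r) :
    PowerSeries.HasSubst (PowerSeries.X * (1 + φ) ^ 2 : Ser r) :=
  PowerSeries.HasSubst.of_constantCoeff_zero' (by simp)

lemma comp_add (φ f g : Ser r) : comp φ (f + g) = comp φ f + comp φ g :=
  PowerSeries.subst_add (hasSubst_change φ) f g

lemma comp_sub (φ f g : Ser r) : comp φ (f - g) = comp φ f - comp φ g :=
  PowerSeries.subst_sub (hasSubst_change φ) f g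

lemma comp_mul (φ f g : Ser r) : comp φ (f * g) = comp φ f * comp φ g :=
  PowerSeries.subst_mul (hasSubst_change φ) f g

lemma comp_cst (φ : Ser r) (x : ℝ) : comp φ (cst x) = cst x :=
  PowerSeries.subst_C _

lemma comp_X_pow (φ : Ser r) (n : ℕ) :
    comp φ (PowerSeries.X ^ n) = PowerSeries.X ^ n * (1 + φ) ^ (2 * n) := by
  rw [comp, PowerSeries.subst_pow (hasSubst_change φ), PowerSeries.subst_X (hasSubst_change φ),
    mul_pow, pow_mul]

/-- The `j`-th term of the series defining `comp φ f`. -/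
noncomputable def compTerm (φ f : Ser r) (j : ℕ) : Ser r :=
  PowerSeries.C (PowerSeries.coeff j f) * (PowerSeries.X ^ j * (1 + φ) ^ (2 * j))

lemma coeff_comp (φ f : Ser r) (n : ℕ) :
    PowerSeries.coeff n (comp φ f) =
      PowerSeries.coeff n (∑ j ∈ Finset.range (n + 1), compTerm φ f j) := by
  rw [comp, PowerSeries.coeff_subst' (hasSubst_change φ), map_sum,
    finsum_eq_sum_of_support_subset (s := Finset.range (n + 1))]
  · refine Finset.sum_congr rfl fun j _ => ?_
    rw [compTerm, PowerSeries.coeff_C_mul, smul_eq_mul, mul_pow, pow_mul]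
  · intro j hj
    by_contra h
    refine hj ?_
    have hj' : ¬ j ≤ n := by simpa [Nat.lt_succ_iff] using h
    simp only [mul_pow, PowerSeries.coeff_X_pow_mul', if_neg hj', smul_zero]

lemma cf_comp (φ f : Ser r) (m : Fin r →₀ ℕ) (n : ℕ) :
    cf m n (comp φ f) = cf m n (∑ j ∈ Finset.range (n + 1), compTerm φ f j) := by
  rw [cf, coeff_comp, cf]

lemma coeff_zero_comp (φ f : Ser r) :
    PowerSeries.coeff 0 (comp φ f) = PowerSeries.coeff 0 f := by
  rw [coeff_comp]
  simp [compTerm]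

lemma monomial_mem_filt {s n : ℕ} {f : Ser r} (hf : f ∈ filt r s n) (j : ℕ) :
    PowerSeries.C (PowerSeries.coeff j f) * PowerSeries.X ^ j ∈ filt r s n :=
  mem_filt.2 fun m i h => by
    have := mem_filt.1 hf m i h
    unfold cf at *
    rw [PowerSeries.coeff_C_mul, PowerSeries.coeff_X_pow]
    split_ifs with hi
    · subst hi
      simpa using this
    · simp

lemma comp_mem_filt {s n : ℕ} (φ : Ser r) {f : Ser r} (hf : f ∈ filt r s n) :
    comp φ f ∈ filt r s n :=
  mem_filt.2 fun m j h => by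
    rw [cf_comp]
    refine mem_filt.1 (Submodule.sum_mem _ fun i _ => ?_) m j h
    rw [compTerm, ← mul_assoc]
    exact mul_mem_filt_left (monomial_mem_filt hf i)

lemma Close.comp {s d p : ℕ} {φ φ' f : Ser r} (h : Close s d 0 φ φ') (hf : f ∈ filt r s p) :
    Close s d p (comp φ f) (comp φ' f) := by
  refine ⟨comp_mem_filt φ hf, comp_mem_filt φ' hf, mem_filt.2 fun m j hm => ?_⟩
  have h1 : Close s d p (∑ i ∈ Finset.range (j + 1), compTerm φ f i)
      (∑ i ∈ Finset.range (j + 1), compTerm φ' f i) := Close.sum fun i _ => by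
    have := (Close.refl d (monomial_mem_filt hf i)).mul (((Close.const d 1).add h).pow (2 * i))
    simpa only [compTerm, mul_assoc, add_zero] using this
  have := mem_filt.1 h1.2.2 m j hm
  rw [cf_sub] at this ⊢
  rw [cf_comp, cf_comp, this]

/-- A near-identity change is the identity to leading order. -/
lemma comp_sub_self_mem_filt {s n : ℕ} {φ f : Ser r} (hφ : φ ∈ filt r s 1)
    (hf : f ∈ filt r s n) : comp φ f - f ∈ filt r s (n + 1) := by
  refine mem_filt.2 fun m j hm => ?_
  have h0 : comp 0 f = f := by simp [comp]
  have h1 : ∑ i ∈ Finset.range (j + 1), compTerm φ f i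
      - ∑ i ∈ Finset.range (j + 1), compTerm 0 f i ∈ filt r s (n + 1) := by
    rw [← Finset.sum_sub_distrib]
    refine Submodule.sum_mem _ fun i _ => ?_
    have h2 := mul_mem_filt (monomial_mem_filt hf i)
      ((Close.refl 0 hφ).one_add_pow_sub_one (2 * i)).1
    have e : compTerm φ f i - compTerm 0 f i =
        PowerSeries.C (PowerSeries.coeff i f) * PowerSeries.X ^ i * ((1 + φ) ^ (2 * i) - 1) := by
      simp only [compTerm, add_zero, one_pow]
      ring
    rwa [e]
  have := mem_filt.1 h1 m j hm
  rw [cf_sub, ← cf_comp, ← cf_comp, h0] at this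
  rwa [cf_sub]

lemma exists_comp_eq {s : ℕ} {φ : Ser r} (hφ : φ ∈ filt r s 1) (K : Ser r) :
    ∃ f, comp φ f = K := by
  obtain ⟨f, -, hf⟩ := exists_fixedPoint (s := s) (b := 0) (fun f => K - (comp φ f - f))
    fun d y z h => ⟨mem_filt_zero _ _, mem_filt_zero _ _, by
      have := neg_mem (comp_sub_self_mem_filt hφ h.2.2)
      rw [comp_sub] at this
      rw [show K - (comp φ y - y) - (K - (comp φ z - z)) =
        -(comp φ y - comp φ z - (y - z)) by ring]
      rwa [← add_assoc]⟩
  exact ⟨f, by linear_combination -hf⟩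

/-! ### Weierstrass division by the Eulerian part -/

/-- The truncation of a series in `R` to the powers below `p`. -/
noncomputable def lowPart (p : ℕ) (f : Ser r) : Ser r :=
  shiftScale 0 (fun j => if j < p then 1 else 0) f

lemma cf_lowPart (m : Fin r →₀ ℕ) (j p : ℕ) (f : Ser r) :
    cf m j (lowPart p f) = if j < p then cf m j f else 0 := by
  simp [lowPart]

/-- The solution `ψ` of `a R^s (ρ ∂ψ/∂ρ) = y - (terms of degree ≤ s in R)`. -/
noncomputable def angleOf (s : ℕ) (a : ℝ) (y : Ser r) : Ser r :=
  shiftScale s (fun j => if j = 0 then 0 else (2 * a * j)⁻¹) y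

lemma angleOf_spec {s : ℕ} {a : ℝ} (ha : a ≠ 0) (y : Ser r) :
    lowPart (s + 1) y + euler (angleOf s a y) * (cst a * PowerSeries.X ^ s) = y := by
  refine ext_cf fun m j => ?_
  rw [show euler (angleOf s a y) * (cst a * PowerSeries.X ^ s) =
    PowerSeries.X ^ s * (cst a * euler (angleOf s a y)) by ring]
  rw [cf_add, cf_lowPart, cf_X_pow_mul]
  simp only [cf_cst_mul, cf_euler, angleOf, cf_shiftScale]
  rcases lt_trichotomy j s with h | h | h
  · rw [if_pos (by omega), if_neg (by omega), add_zero]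
  · subst h
    simp
  · have h1 : j - s ≠ 0 := by omega
    have h2 : ((j - s : ℕ) : ℝ) ≠ 0 := by exact_mod_cast h1
    rw [if_neg (by omega), if_pos h.le, if_neg h1, Nat.sub_add_cancel h.le]
    field_simp
    ring

lemma exists_division {s : ℕ} {a : ℝ} (ha : a ≠ 0) {α : Ser r} (hα : α ∈ filt r s (s + 1))
    (K : Ser r) :
    ∃ y ψ : Ser r, PowerSeries.coeff 0 ψ = 0 ∧ PowerSeries.coeff 0 y = PowerSeries.coeff 0 K ∧
      lowPart (s + 1) y + euler ψ * (cst a * PowerSeries.X ^ s + α) = K := by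
  have hlip : ∀ d (u : Ser r), u ∈ filt r s d →
      euler (angleOf s a u) * α ∈ filt r s (d + 1) := by
    intro d u hu
    rcases le_total s d with h | h
    · obtain ⟨e, rfl⟩ := Nat.exists_eq_add_of_le' h
      exact filt_anti (by omega)
        (mul_mem_filt (euler_mem_supportedSer (shiftScale_mem_filt s _ hu)) hα)
    · exact filt_anti (by omega) (mul_mem_filt_right hα)
  obtain ⟨y, -, hy⟩ := exists_fixedPoint (s := s) (b := 0)
    (fun y => K - euler (angleOf s a y) * α)
    fun d y z h => ⟨mem_filt_zero _ _, mem_filt_zero _ _, by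
      have := neg_mem (hlip _ _ h.2.2)
      rw [angleOf, shiftScale_sub, euler_sub] at this
      rw [show K - euler (angleOf s a y) * α - (K - euler (angleOf s a z) * α) =
        -((euler (angleOf s a y) - euler (angleOf s a z)) * α) by ring]
      rwa [← add_assoc]⟩
  refine ⟨y, angleOf s a y, ?_, ?_, ?_⟩
  · simp [angleOf, shiftScale]
  · rw [← hy]
    simp [euler]
  · linear_combination angleOf_spec ha y - hy

/-! ### Normal form of the radial equation -/

/-- The conjugating factor `φ` extracted from the unknown series: it solves the homological
equation `a R^s (ρ ∂φ/∂ρ - 2 s φ) = y` in all powers `R^j` with `s ≤ j`, apart from the resonant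
power `j = 2 s`. -/
noncomputable def radialOf (s : ℕ) (a : ℝ) (y : Ser r) : Ser r :=
  shiftScale s (fun j => if j = s then 0 else (2 * a * ((j : ℝ) - s))⁻¹) y

/-- The resonant term `β R^s` of the rotation extracted from the unknown series. -/
noncomputable def resonantOf (s : ℕ) (c : ℝ) (y : Ser r) : Ser r :=
  PowerSeries.X ^ s * shiftScale (s + s) (fun j => if j = 0 then c else 0) y

/-- The homological equation is solved exactly: powers of `R` below `s` by the polynomial part, the
resonant power `2 s` by the residue, all others by the conjugating factor. -/
lemma homological_spec {s : ℕ} (hs : 0 < s) {a w : ℝ} (ha : a ≠ 0) (hw : w ≠ 0) (y : Ser r) :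
    cst a * PowerSeries.X ^ s * (euler (radialOf s a y) - cst (2 * s) * radialOf s a y)
      + lowPart s y
      - cst (a / w) * PowerSeries.X ^ s * resonantOf s (-(w / a)) y = y := by
  refine ext_cf fun m j => ?_
  rw [show cst a * PowerSeries.X ^ s * (euler (radialOf s a y) - cst (2 * s) * radialOf s a y)
      + lowPart s y
      - cst (a / w) * PowerSeries.X ^ s * resonantOf s (-(w / a)) y =
      PowerSeries.X ^ s * (cst a * (euler (radialOf s a y) - cst (2 * s) * radialOf s a y))
      + lowPart s y
      - PowerSeries.X ^ s * (cst (a / w) * resonantOf s (-(w / a)) y) by ring]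
  simp only [cf_add, cf_sub, cf_X_pow_mul, cf_cst_mul, cf_euler, cf_lowPart, radialOf,
    cf_shiftScale, resonantOf]
  rcases lt_or_ge j s with h | h
  · rw [if_neg (by omega), if_pos h, if_neg (by omega)]
    ring
  · obtain ⟨i, rfl⟩ := Nat.exists_eq_add_of_le h
    simp only [Nat.add_sub_cancel_left, if_pos h, if_neg (not_lt.2 h)]
    by_cases hi : i = s
    · subst hi
      simp
      field_simp
    · have h2 : (i : ℝ) - s ≠ 0 := sub_ne_zero.2 (by exact_mod_cast hi)
      have h3 : (if s ≤ i then (if i - s = 0 then -(w / a) else 0) *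
          cf m (i - s + (s + s)) y else 0) = 0 := by
        split_ifs <;> first | omega | simp
      rw [h3, if_neg hi, add_comm s i]
      field_simp
      ring

/-- The parametric vector field `R' = 2 R H` on the line, with `H = (a / w) R^s + …`, can be
brought by a near-identity change of `R` to `R' = 2 R (a R^s + α) / (w + β R^s)`, where `α` has
degree below `s`; here `u` is the unknown series encoding `φ`, `α` and `β`. -/
lemma exists_radial_normalForm {s : ℕ} (hs : 0 < s) {a w : ℝ} (ha : a ≠ 0) (hw : w ≠ 0)
    {H : Ser r} (hH : H - cst (a / w) * PowerSeries.X ^ s ∈ filt r s (s + 1)) :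
    ∃ u ∈ filt r s (s + 1), ∃ φ ∈ filt r s 1,
      (1 + φ + euler φ) * (cst a * PowerSeries.X ^ s + lowPart s u) =
        (1 + φ) * (comp φ H * (cst w + resonantOf s (-(w / a)) u)) := by
  obtain ⟨H₁, rfl⟩ : ∃ H₁, H = cst (a / w) * PowerSeries.X ^ s + H₁ :=
    ⟨_, (add_sub_cancel _ _).symm⟩
  rw [add_sub_cancel_left] at hH
  set c := -(w / a)
  let Φ : Ser r → Ser r := fun y =>
    cst a * PowerSeries.X ^ s * ((1 + radialOf s a y) ^ (2 * s + 1) - 1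
        - ((2 * s + 1 : ℕ) : Ser r) * radialOf s a y)
      + cst (a / w) * PowerSeries.X ^ s *
        (resonantOf s c y * ((1 + radialOf s a y) ^ (2 * s + 1) - 1))
      - (radialOf s a y + euler (radialOf s a y)) * lowPart s y
      + (1 + radialOf s a y) * (comp (radialOf s a y) H₁ * (cst w + resonantOf s c y))
  -- `Φ y = y` is the conjugacy equation with its leading linear part, which is `y`, split off.
  obtain ⟨u, hu, hfix⟩ := exists_fixedPoint (s := s) (b := s + 1) Φ fun d y z h => by
    have hφ : Close s d 1 (radialOf s a y) (radialOf s a z) :=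
      Close.shiftScale _ (h.trade (by omega) (by omega))
    have hα : Close s d (s + 1) (lowPart s y) (lowPart s z) := Close.shiftScale _ h
    have hX : ∀ x : ℝ, Close s d s (cst x * PowerSeries.X ^ s : Ser r)
        (cst x * PowerSeries.X ^ s) :=
      fun x => Close.refl d (mul_mem_filt_right (X_pow_mem_filt s s))
    have hB : Close s d 1 (resonantOf s c y) (resonantOf s c z) := by
      have hB' : ∀ v ∈ filt r s (s + 1), resonantOf s c v ∈ filt r s 1 := fun v _ =>
        filt_anti hs (mul_mem_filt_left (X_pow_mem_filt s s))
      refine ⟨hB' y h.1, hB' z h.2.1, ?_⟩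
      rw [resonantOf, resonantOf, ← mul_sub, ← shiftScale_sub]
      rcases le_total s (1 + d) with hd | hd
      · obtain ⟨e, he⟩ := Nat.exists_eq_add_of_le' hd
        rw [he, add_comm e s]
        exact mul_mem_filt (X_pow_mem_filt s s)
          (shiftScale_mem_filt _ _ (filt_anti (by omega) h.2.2))
      · exact filt_anti hd (mul_mem_filt_left (X_pow_mem_filt s s))
    have hφ' := hφ.one_add
    have h1 := (hX a).mul (hφ.one_add_pow_sub_linear (2 * s + 1))
    have h2 := (hX (a / w)).mul (hB.mul (hφ.one_add_pow_sub_one (2 * s + 1)))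
    have h3 := (hφ.add hφ.euler).mul hα
    have h4 := hφ'.mul (((hφ.trade (Nat.zero_le _) (by omega) :
      Close s (d + 1) 0 _ _).comp hH).mul
        ((Close.const (d + 1) (cst w)).add (hB.trade (Nat.zero_le _) (by omega))))
    exact (((h1.trade (by omega) (by omega)).add (h2.trade (by omega) (by omega))).sub
      (h3.trade (by omega) (by omega))).add (h4.trade (by omega) (by omega))
  refine ⟨u, hu, radialOf s a u, shiftScale_mem_filt s _ (filt_anti (by omega) hu), ?_⟩
  have hlin := homological_spec hs ha hw u
  rw [comp_add, comp_mul, comp_cst, comp_X_pow]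
  have e1 : (cst (a / w) * cst w : Ser r) = cst a := by
    rw [cst_mul_cst, div_mul_cancel₀ a hw]
  have e2 : (cst (2 * s) : Ser r) = 2 * (s : Ser r) := by
    rw [← cst_mul_cst, cst, cst, map_ofNat, map_ofNat, map_natCast, map_natCast]
  rw [e2] at hlin
  simp only [Φ] at hfix
  push_cast at hfix
  linear_combination hlin - hfix - PowerSeries.X ^ s * (1 + radialOf s a u) ^ (2 * s + 1) * e1

variable {n k : ℕ}

/-! ### Passing from series in `R` to vector fields on the leaf -/

lemma ratio_last (hk : 0 < k) (hkn : k ≤ n) {σ : Equiv.Perm (Fin n)} {C : Fin n → ℝ}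
    (hC : C ∈ leafLabels n k σ) : ratio r hk hkn σ C (lastIdx hk) = 1 := by
  have h : C (sel hkn σ (lastIdx hk)) ≠ 0 := (hC.2.1 _ (lastIdx hk).2).ne'
  simp [ratio, div_self h]

lemma inSq_mul (f g : Ser r) : inSq (f * g) = inSq f * inSq g := map_mul _ f g

lemma inSq_add (f g : Ser r) : inSq (f + g) = inSq f + inSq g := map_add _ f g

lemma inSq_one : inSq (1 : Ser r) = 1 := map_one _

lemma X_mul_derivative_inSq (f : Ser r) :
    PowerSeries.X * PowerSeries.derivative (Param r) (inSq f) = inSq (euler f) := by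
  have h : inSq f = PowerSeries.subst (PowerSeries.X ^ 2 : Ser r) f :=
    PowerSeries.expand_apply 2 two_ne_zero f
  have h' : PowerSeries.subst (PowerSeries.X ^ 2 : Ser r) (PowerSeries.derivative (Param r) f) =
      inSq (PowerSeries.derivative (Param r) f) := (PowerSeries.expand_apply 2 two_ne_zero _).symm
  have h2 : inSq (2 : Ser r) = 2 := map_ofNat _ 2
  have hX : inSq (PowerSeries.X : Ser r) = PowerSeries.X ^ 2 := PowerSeries.expand_X 2 two_ne_zero
  rw [h, PowerSeries.derivative_subst (PowerSeries.HasSubst.X_pow two_ne_zero), h',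
    PowerSeries.derivative_pow, euler, inSq_mul, inSq_mul, h2, hX]
  simp
  ring

lemma subst_inSq (φ f : Ser r) :
    PowerSeries.subst (PowerSeries.X * (1 + inSq φ) : Ser r) (inSq f) = inSq (comp φ f) := by
  have h1 : PowerSeries.HasSubst (PowerSeries.X * (1 + inSq φ) : Ser r) :=
    PowerSeries.HasSubst.of_constantCoeff_zero' (by simp)
  have h2 : PowerSeries.HasSubst (PowerSeries.X ^ 2 : Ser r) :=
    PowerSeries.HasSubst.X_pow two_ne_zero
  have h3 : inSq f = PowerSeries.subst (PowerSeries.X ^ 2 : Ser r) f :=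
    PowerSeries.expand_apply 2 two_ne_zero f
  have h4 : inSq (comp φ f) =
      PowerSeries.subst (inSq (PowerSeries.X * (1 + φ) ^ 2 : Ser r)) f :=
    PowerSeries.expand_subst 2 two_ne_zero (hasSubst_change φ) f
  have h5 : inSq (PowerSeries.X * (1 + φ) ^ 2 : Ser r) =
      (PowerSeries.X * (1 + inSq φ)) ^ 2 := by
    have hX : inSq (PowerSeries.X : Ser r) = PowerSeries.X ^ 2 :=
      PowerSeries.expand_X 2 two_ne_zero
    rw [pow_two (1 + φ), inSq_mul, inSq_mul, inSq_add, inSq_one, hX]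
    ring
  rw [h3, PowerSeries.subst_comp_subst_apply h2 h1, PowerSeries.subst_pow h1,
    PowerSeries.subst_X h1, h4, h5]

/-- The conjugacy of leaf fields, expressed by series in `R = ρ²`. -/
lemma transforms_of_comp (hk : 0 < k) (hkn : k ≤ n) {σ : Equiv.Perm (Fin n)} {C : Fin n → ℝ}
    (hC : C ∈ leafLabels n k σ) {T φ : Ser r} {ψ : Fin k → Ser r} {v w : LeafAlg k r}
    (h1 : (1 + φ + euler φ) * w.1 = (1 + φ) * comp φ ((1 + T) * v.1))
    (h2 : ∀ i, w.2 i + euler (ψ i) * w.1 = comp φ ((1 + T) * v.2 i)) :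
    Transforms hk (leafChange hk hkn σ C φ ψ) (timeRescale T (toField hk hkn σ C v))
      (toField hk hkn σ C w) := by
  have hlast := ratio_last (r := r) hk hkn hC
  have hT : ∀ f : Ser r, (1 + inSq T) * inSq f = inSq ((1 + T) * f) := fun f => by
    rw [inSq_mul, inSq_add, inSq_one]
  have hsub : PowerSeries.HasSubst (PowerSeries.X * (1 + inSq φ) : Ser r) :=
    PowerSeries.HasSubst.of_constantCoeff_zero' (by simp)
  refine ⟨fun j => ?_, fun i => ?_⟩
  · have e1 : PowerSeries.derivative (Param r)
        (ratio r hk hkn σ C j * PowerSeries.X * (1 + inSq φ)) =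
        ratio r hk hkn σ C j * inSq (1 + φ + euler φ) := by
      have hc : PowerSeries.derivative (Param r) (ratio r hk hkn σ C j) = 0 :=
        PowerSeries.derivative_C
      rw [inSq_add, inSq_add, inSq_one, ← X_mul_derivative_inSq]
      simp [hc]
      ring
    have e2 : PowerSeries.subst (PowerSeries.X * (1 + inSq φ) : Ser r) (ratio r hk hkn σ C j) =
        ratio r hk hkn σ C j := PowerSeries.subst_C _
    simp only [leafChange, timeRescale, toField, hlast, one_mul]
    rw [e1, show (1 + inSq T) * (ratio r hk hkn σ C j * PowerSeries.X * inSq v.1) =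
      ratio r hk hkn σ C j * PowerSeries.X * ((1 + inSq T) * inSq v.1) by ring, hT,
      PowerSeries.subst_mul hsub, PowerSeries.subst_mul hsub, PowerSeries.subst_X hsub, e2,
      subst_inSq]
    have := congrArg inSq h1
    rw [inSq_mul, inSq_mul, inSq_add 1 φ, inSq_one] at this
    linear_combination ratio r hk hkn σ C j * PowerSeries.X * this
  · simp only [leafChange, timeRescale, toField, hlast, one_mul]
    rw [hT, subst_inSq, ← h2 i, inSq_add, inSq_mul, ← X_mul_derivative_inSq]
    ring

lemma cf_sum_range (m : Fin r →₀ ℕ) (j s : ℕ) (a : ℕ → Param r) :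
    cf m j (∑ i ∈ Finset.range (s + 1), PowerSeries.C (a i) * PowerSeries.X ^ i) =
      if j ≤ s then MvPowerSeries.coeff m (a j) else 0 := by
  unfold cf
  rw [map_sum]
  simp only [PowerSeries.coeff_C_mul, PowerSeries.coeff_X_pow, mul_ite, mul_one, mul_zero]
  rw [Finset.sum_ite_eq]
  simp only [Finset.mem_range, Nat.lt_succ_iff]
  split_ifs <;> simp

lemma sum_range_eq_lowPart (s : ℕ) (f : Ser r) :
    ∑ i ∈ Finset.range (s + 1), PowerSeries.C (PowerSeries.coeff i f) * PowerSeries.X ^ i =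
      lowPart (s + 1) f :=
  ext_cf fun m j => by
    rw [cf_sum_range, cf_lowPart]
    simp only [Nat.lt_succ_iff, cf]

lemma cf_mk (m : Fin r →₀ ℕ) (j : ℕ) (a : ℕ → Param r) :
    cf m j (PowerSeries.mk a) = MvPowerSeries.coeff m (a j) := by
  rw [cf, PowerSeries.coeff_mk]

lemma atZero_eq_coeff (x : Param r) : atZero x = MvPowerSeries.coeff 0 x :=
  (MvPowerSeries.coeff_zero_eq_constantCoeff_apply x).symm

lemma value00_eq_cf (f : Ser r) : value00 f = cf 0 0 f := atZero_eq_coeff _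

lemma weight_lt_succ_iff {s j : ℕ} {m : Fin r →₀ ℕ} :
    weight s 0 m j < s + 1 ↔ m = 0 ∧ j ≤ s := by
  unfold weight
  constructor
  · intro h
    have hm : m.degree = 0 := by
      by_contra h0
      have := Nat.mul_le_mul_right (s + 1) (Nat.one_le_iff_ne_zero.2 h0)
      omega
    refine ⟨(Finsupp.degree_eq_zero_iff m).1 hm, by omega⟩
  · rintro ⟨rfl, h⟩
    simp
    omega

lemma cf_zero_mul (f g : Ser r) : cf 0 0 (f * g) = cf 0 0 f * cf 0 0 g := by
  simp [cf]

lemma exists_mul_eq_one {f : Ser r} (hf : cf 0 0 f ≠ 0) : ∃ g, f * g = 1 := by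
  have : IsUnit f := by
    rw [PowerSeries.isUnit_iff_constantCoeff, MvPowerSeries.isUnit_iff_constantCoeff,
      isUnit_iff_ne_zero]
    simpa [cf] using hf
  exact this.exists_right_inv

/-- A series whose values at `μ = 0` start with `a R^s` differs from `a R^s` by terms of weight
above `s`. -/
lemma sub_leading_mem_filt {s : ℕ} {a : ℝ} {f : Ser r} (h0 : ∀ j < s, cf 0 j f = 0)
    (hs : cf 0 s f = a) : f - cst a * PowerSeries.X ^ s ∈ filt r s (s + 1) :=
  mem_filt.2 fun m j h => by
    obtain ⟨rfl, hj⟩ := weight_lt_succ_iff.1 h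
    rw [mul_comm, cf_sub, cf_X_pow_mul]
    rcases hj.lt_or_eq with hj | rfl
    · rw [h0 j hj, if_neg (by omega), sub_zero]
    · rw [if_pos le_rfl, hs, cf_cst]
      simp

/-- Every parametric leaf field whose Eulerian part starts with `a_s(0) R^s` is brought to the
finite form of degree `s` in `R`. -/
theorem exists_finite_normalForm (hk : 0 < k) (hkn : k ≤ n)
    (σ : Equiv.Perm (Fin n)) (C : Fin n → ℝ) (hC : C ∈ leafLabels n k σ)
    (ω : Fin n → ℝ) (hω : ∀ i, ω i ≠ 0)
    (a : ℕ → Param r) (b : Fin k → ℕ → Param r)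
    (ha : atZero (a 0) = 0) (hb : ∀ i, atZero (b i 0) = 0)
    (s : ℕ) (hs : IsLeast {j | atZero (a j) ≠ 0} s) :
    ∃ (T φ : Ser r) (ψ : Fin k → Ser r) (a' : ℕ → Param r) (b' : Fin k → ℕ → Param r),
      value00 T = 0 ∧ value00 φ = 0 ∧ (∀ i, value00 (ψ i) = 0) ∧
      Transforms hk (leafChange hk hkn σ C φ ψ)
        (timeRescale T (toField hk hkn σ C (parametricField hkn σ ω a b)))
        (toField hk hkn σ C (finiteField hkn σ ω s a' b')) ∧
      (∀ j < s, atZero (a' j) = 0) ∧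
      (∀ i, atZero (b' i 0) = 0) ∧
      (∀ j < s, b' (firstIdx hk) j = 0) ∧
      a' s = MvPowerSeries.C (atZero (a s)) := by
  have hs0 : 0 < s := Nat.pos_of_ne_zero fun h => hs.1 (h ▸ ha)
  have hlow : ∀ j < s, atZero (a j) = 0 := fun j hj => by
    by_contra h
    exact absurd (hs.2 h) (not_le.2 hj)
  set A := atZero (a s) with hA
  have hA0 : A ≠ 0 := hs.1
  set v := parametricField hkn σ ω a b with hv
  let w : Fin k → ℝ := fun i => ω (sel hkn σ i)
  have hw : ∀ i, w i ≠ 0 := fun i => hω _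
  have hq : ∀ i, v.2 i = cst (w i) + PowerSeries.mk (b i) := fun i => rfl
  have hq0 : ∀ i, cf 0 0 (v.2 i) = w i := fun i => by
    rw [hq, cf_add, cf_mk, ← atZero_eq_coeff, hb, cf_cst]
    simp
  have hh : ∀ j, cf 0 j v.1 = atZero (a j) := fun j => by
    rw [atZero_eq_coeff]
    exact cf_mk _ _ _
  set e := firstIdx hk with he
  -- The orbits are those of the field divided by its first frequency.
  obtain ⟨g, hg⟩ := exists_mul_eq_one (f := v.2 e) (by rw [hq0]; exact hw e)
  have hg0 : cf 0 0 g = (w e)⁻¹ := by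
    have := congrArg (cf 0 0) hg
    rw [cf_zero_mul, hq0, ← cst_one, cf_cst] at this
    simp only [and_self, if_true] at this
    exact eq_inv_of_mul_eq_one_right this
  have hH : v.1 * g - cst (A / w e) * PowerSeries.X ^ s ∈ filt r s (s + 1) := by
    have h1 := sub_leading_mem_filt (f := v.1) (a := A)
      (fun j hj => by rw [hh, hlow j hj]) (hh s)
    have h2 : g - cst (w e)⁻¹ ∈ filt r s 1 := mem_filt.2 fun m j hm => by
      obtain ⟨rfl, rfl⟩ : m = 0 ∧ j = 0 := by
        obtain ⟨rfl, -⟩ := weight_lt_succ_iff.1 (hm.trans_le (by omega))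
        exact ⟨rfl, by simpa [weight] using hm⟩
      rw [cf_sub, hg0, cf_cst]
      simp
    have h3 := add_mem (mul_mem_filt_left (g := g) h1)
      (mul_mem_filt (mul_mem_filt_right (f := cst A) (X_pow_mem_filt (r := r) s s)) h2)
    have e1 : (cst A * cst (w e)⁻¹ : Ser r) = cst (A / w e) := by
      rw [cst_mul_cst, div_eq_mul_inv]
    convert h3 using 1
    linear_combination PowerSeries.X ^ s * e1
  obtain ⟨u, hu, φ, hφ, hrad⟩ := exists_radial_normalForm hs0 hA0 (hw e) hH
  set B := resonantOf s (-(w e / A)) u with hB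
  have hu0 : ∀ j ≤ s, cf 0 j u = 0 := fun j hj =>
    mem_filt.1 hu 0 j (weight_lt_succ_iff.2 ⟨rfl, hj⟩)
  -- The time rescaling makes the first frequency equal to `ω + β R^s`.
  obtain ⟨V, hV⟩ := exists_comp_eq hφ (cst (w e) + B)
  have hBcf : ∀ m j, cf m j B = if j = s then -(w e / A) * cf m (s + s) u else 0 := fun m j => by
    rw [hB, resonantOf, cf_X_pow_mul]
    by_cases hjs : j = s
    · subst hjs
      simp
    · rw [if_neg hjs]
      by_cases hle : s ≤ j
      · have : j - s ≠ 0 := by omega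
        simp [this]
      · rw [if_neg hle]
  have hV0 : cf 0 0 V = w e := by
    have := congrArg (cf 0 0) hV
    rw [cf_add, cf_cst, hBcf, if_neg hs0.ne, add_zero, cf, coeff_zero_comp, ← cf] at this
    simpa only [and_self, if_true] using this
  have hT1 : 1 + (V * g - 1) = V * g := by ring
  have hα : lowPart s u ∈ filt r s (s + 1) := shiftScale_mem_filt 0 _ hu
  -- The other angles are straightened by Weierstrass division by the Eulerian part.
  choose y ψ hψ0 hy0 hdiv using fun i =>
    exists_division hA0 hα (comp φ (V * g * v.2 i) - cst (w i))
  let a' : ℕ → Param r := fun j =>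
    if j = s then MvPowerSeries.C A else PowerSeries.coeff j u
  let b' : Fin k → ℕ → Param r := fun i j =>
    if i = e then PowerSeries.coeff j B else PowerSeries.coeff j (y i)
  have hw1 : (finiteField hkn σ ω s a' b').1 = cst A * PowerSeries.X ^ s + lowPart s u := by
    refine ext_cf fun m j => ?_
    simp only [finiteField]
    rw [cf_sum_range, mul_comm, cf_add, cf_X_pow_mul, cf_lowPart, cf_cst]
    simp only [a']
    rcases lt_trichotomy j s with h | h | h
    · simp [h, h.le, h.ne, h.not_ge, cf]
    · subst h
      simp [MvPowerSeries.coeff_C]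
    · have : j - s ≠ 0 := by omega
      simp [h.not_gt, h.not_ge, this]
  have hw2e : (finiteField hkn σ ω s a' b').2 e = cst (w e) + B := by
    simp only [finiteField, b', if_true]
    rw [sum_range_eq_lowPart]
    refine congrArg (cst (w e) + ·) (ext_cf fun m j => ?_)
    rw [cf_lowPart, hBcf]
    split_ifs <;> first | rfl | omega
  have hw2 : ∀ i ≠ e, (finiteField hkn σ ω s a' b').2 i = cst (w i) + lowPart (s + 1) (y i) := by
    intro i hi
    simp only [finiteField, b', if_neg hi]
    rw [sum_range_eq_lowPart]
    rfl
  refine ⟨V * g - 1, φ, fun i => if i = e then 0 else ψ i, a', b', ?_, ?_, fun i => ?_, ?_,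
    fun j hj => ?_, fun i => ?_, fun j hj => ?_, ?_⟩
  · rw [value00_eq_cf, cf_sub, cf_zero_mul, hV0, hg0, ← cst_one, cf_cst, mul_inv_cancel₀ (hw e)]
    simp
  · rw [value00_eq_cf]
    exact mem_filt.1 hφ 0 0 (by simp [weight])
  · by_cases hi : i = e
    · simp [hi, value00_eq_cf]
    · simp only [if_neg hi]
      rw [value00, hψ0]
      simp [atZero]
  · refine transforms_of_comp hk hkn hC ?_ fun i => ?_
    · rw [hw1, hrad, hT1, ← hV, ← comp_mul]
      congr 2
      ring
    · rw [hT1]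
      by_cases hi : i = e
      · subst hi
        rw [if_pos rfl, hw2e, euler_zero, zero_mul, add_zero, ← hV]
        congr 1
        linear_combination -V * hg
      · rw [if_neg hi, hw2 i hi, hw1]
        linear_combination hdiv i
  · simp only [a', if_neg hj.ne]
    rw [atZero_eq_coeff]
    exact hu0 j hj.le
  · simp only [b']
    split_ifs with hi
    · rw [atZero_eq_coeff]
      exact (hBcf 0 0).trans (if_neg hs0.ne)
    · rw [hy0, atZero_eq_coeff, map_sub, coeff_zero_comp]
      change cf 0 0 (V * g * v.2 i) - cf 0 0 (cst (w i)) = 0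
      rw [cf_zero_mul, cf_zero_mul, hV0, hg0, hq0, cf_cst, mul_inv_cancel₀ (hw e)]
      simp
  · simp only [b', if_true]
    refine MvPowerSeries.ext fun m => ?_
    exact (hBcf m j).trans (if_neg hj.ne)
  · simp [a']

variable {s : ℕ}

/-! ### Homogeneous fields and generators -/

lemma mem_supportedFields {P : (Fin r →₀ ℕ) → ℕ → Prop} {Q : Fin k → (Fin r →₀ ℕ) → ℕ → Prop}
    {v : LeafAlg k r} : v ∈ supportedFields P Q ↔
      (∀ m j, ¬ P m j → cf m j v.1 = 0) ∧ ∀ i m j, ¬ Q i m j → cf m j (v.2 i) = 0 := by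
  simp only [supportedFields, Submodule.mem_prod, Submodule.mem_pi, Set.mem_univ, true_implies]
  rfl

lemma mem_homFields {d : ℕ} {v : LeafAlg k r} : v ∈ homFields k r s d ↔
    (∀ m j, weight s 0 m j ≠ d → cf m j v.1 = 0) ∧
      ∀ i m j, weight s s m j ≠ d → cf m j (v.2 i) = 0 :=
  mem_supportedFields

lemma mem_homGens {d : ℕ} {X : Gen k r} : X ∈ homGens k r s d ↔
    (∀ m j, weight s 0 m j ≠ d → cf m j X.1 = 0) ∧ X.2 ∈ homFields k r s d :=
  Iff.rfl

lemma weight_eq_add (s d : ℕ) (m : Fin r →₀ ℕ) (j : ℕ) :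
    weight s d m j = weight s 0 m j + d := by
  unfold weight
  omega

lemma weight_add_right (s d : ℕ) (m : Fin r →₀ ℕ) (i j : ℕ) :
    weight s d m (i + j) = weight s d m i + j := by
  unfold weight
  omega

lemma weight_zero_zero (s d j : ℕ) : weight s d (0 : Fin r →₀ ℕ) j = d + j := by
  simp [weight]

@[simp] lemma cf_part_fst (m : Fin r →₀ ℕ) (j l : ℕ) (v : LeafAlg k r) :
    cf m j (part s l v).1 = if weight s 0 m j = l then cf m j v.1 else 0 :=
  cf_ofCf m j fun m j => if weight s 0 m j = l then cf m j v.1 else 0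

@[simp] lemma cf_part_snd (m : Fin r →₀ ℕ) (j l : ℕ) (v : LeafAlg k r) (i : Fin k) :
    cf m j ((part s l v).2 i) = if weight s s m j = l then cf m j (v.2 i) else 0 :=
  cf_ofCf m j fun m j => if weight s s m j = l then cf m j (v.2 i) else 0

lemma part_mem_homFields (l : ℕ) (v : LeafAlg k r) : part s l v ∈ homFields k r s l :=
  mem_homFields.2 ⟨fun m j h => by simp [h], fun i m j h => by simp [h]⟩

lemma ext_field {v w : LeafAlg k r} (h : ∀ m j, cf m j v.1 = cf m j w.1)
    (h' : ∀ i m j, cf m j (v.2 i) = cf m j (w.2 i)) : v = w :=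
  Prod.ext (ext_cf h) (funext fun i => ext_cf (h' i))

lemma act_apply (v : LeafAlg k r) (X : Gen k r) :
    act v X = (X.1 * v.1 + (euler X.2.1 * v.1 - euler v.1 * X.2.1),
      fun i => X.1 * v.2 i + (euler (X.2.2 i) * v.1 - euler (v.2 i) * X.2.1)) := rfl

lemma act_zero_left (X : Gen k r) : act 0 X = 0 := by
  rw [act_apply]
  refine Prod.ext ?_ (funext fun i => ?_) <;> simp [euler_zero]

lemma dMap_apply (v : LeafAlg k r) (q : ℕ) (X : ℕ → Gen k r) :
    dMap s v q X =
      ∑ p ∈ Finset.HasAntidiagonal.antidiagonal q, act (part s p.2 v) (X p.1) := by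
  simp [dMap]

/-! ### The leading part of the homological operator -/

/-- The leading field `A ρ^{2s} Ê₀ + ∑ w_i ∂/∂θ_{σ(i)}`. -/
noncomputable def lead (r s : ℕ) (A : ℝ) (w : Fin k → ℝ) : LeafAlg k r :=
  (cst A * PowerSeries.X ^ s, fun i => cst (w i))

lemma euler_cst (x : ℝ) : euler (cst x : Ser r) = 0 :=
  ext_cf fun m j => by
    rw [cf_euler, cf_cst]
    split_ifs with h <;> simp [h]

lemma euler_lead (A : ℝ) :
    euler (cst A * PowerSeries.X ^ s : Ser r) = cst (2 * s) * (cst A * PowerSeries.X ^ s) :=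
  ext_cf fun m j => by
    rw [mul_comm (cst A), cf_euler, cf_cst_mul, cf_X_pow_mul, cf_cst]
    by_cases hj : m = 0 ∧ j = s
    · simp [hj.2]
    · have : ¬ (s ≤ j ∧ m = 0 ∧ j - s = 0) := by
        rintro ⟨h1, h2, h3⟩
        exact hj ⟨h2, by omega⟩
      split_ifs <;> simp_all

lemma act_lead (A : ℝ) (w : Fin k → ℝ) (X : Gen k r) :
    act (lead r s A w) X =
      (PowerSeries.X ^ s * (cst A * (X.1 + euler X.2.1 - cst (2 * s) * X.2.1)),
        fun i => cst (w i) * X.1 + PowerSeries.X ^ s * (cst A * euler (X.2.2 i))) := by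
  rw [act_apply]
  refine Prod.ext ?_ (funext fun i => ?_)
  · simp only [lead, euler_lead]
    ring
  · simp only [lead, euler_cst]
    ring

lemma cf_act_lead_fst (A : ℝ) (w : Fin k → ℝ) (X : Gen k r) (m : Fin r →₀ ℕ) (j : ℕ) :
    cf m (s + j) (act (lead r s A w) X).1 =
      A * (cf m j X.1 + 2 * ((j : ℝ) - s) * cf m j X.2.1) := by
  rw [act_lead, cf_X_pow_mul, if_pos (Nat.le_add_right s j), Nat.add_sub_cancel_left]
  simp
  ring_nf
  simp

lemma cf_act_lead_fst_of_lt (A : ℝ) (w : Fin k → ℝ) (X : Gen k r) (m : Fin r →₀ ℕ) {j : ℕ}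
    (hj : j < s) : cf m j (act (lead r s A w) X).1 = 0 := by
  rw [act_lead, cf_X_pow_mul, if_neg hj.not_ge]

lemma cf_act_lead_snd (A : ℝ) (w : Fin k → ℝ) (X : Gen k r) (i : Fin k) (m : Fin r →₀ ℕ)
    (j : ℕ) : cf m (s + j) ((act (lead r s A w) X).2 i) =
      w i * cf m (s + j) X.1 + 2 * A * j * cf m j (X.2.2 i) := by
  rw [act_lead, cf_add, cf_X_pow_mul, if_pos (Nat.le_add_right s j), Nat.add_sub_cancel_left]
  simp
  ring

lemma cf_act_lead_snd_of_le (A : ℝ) (w : Fin k → ℝ) (X : Gen k r) (i : Fin k)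
    (m : Fin r →₀ ℕ) {j : ℕ} (hj : j ≤ s) :
    cf m j ((act (lead r s A w) X).2 i) = w i * cf m j X.1 := by
  rcases hj.lt_or_eq with h | rfl
  · rw [act_lead, cf_add, cf_X_pow_mul, if_neg h.not_ge]
    simp
  · simpa using cf_act_lead_snd A w X i m 0

lemma act_lead_mem_homFields (A : ℝ) (w : Fin k → ℝ) {d : ℕ} {X : Gen k r}
    (hX : X ∈ homGens k r s d) : act (lead r s A w) X ∈ homFields k r s (d + s) := by
  obtain ⟨h1, h2, h3⟩ := mem_homGens.1 hX |>.imp_right mem_homFields.1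
  refine mem_homFields.2 ⟨fun m j hw => ?_, fun i m j hw => ?_⟩
  · rcases lt_or_ge j s with h | h
    · exact cf_act_lead_fst_of_lt A w X m h
    · obtain ⟨i, rfl⟩ := Nat.exists_eq_add_of_le' h
      rw [weight_add_right] at hw
      rw [add_comm, cf_act_lead_fst, h1 m i (by omega), h2 m i (by omega)]
      simp
  · rw [weight_eq_add] at hw
    rcases le_or_gt j s with h | h
    · rw [cf_act_lead_snd_of_le A w X i m h, h1 m j (by omega), mul_zero]
    · obtain ⟨l, rfl⟩ := Nat.exists_eq_add_of_le' h.le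
      rw [add_comm, cf_act_lead_snd, add_comm s l, h1 m _ (by omega),
        h3 i m l (by rw [weight_eq_add]; rw [weight_add_right] at hw; omega)]
      simp

/-! ### Lifting the kernel of the leading operator -/

/-- Modulo generators that are constant along `ρ`, the kernel of the leading operator consists of
the pairs `(-(ρ ∂f/∂ρ) h, f v)` with `v = h Ê₀ + …` the leading field: time rescalings undone by
the flow of `f v` itself. -/
lemma exists_multiplier_of_act_lead_eq_zero {A : ℝ} (hA : A ≠ 0) {w : Fin k → ℝ} {e : Fin k}
    (hw : w e ≠ 0) {d : ℕ} {X : Gen k r} (hX : X ∈ homGens k r s d)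
    (h : act (lead r s A w) X = 0) :
    ∃ f ∈ supportedSer fun m j => weight s 0 m j + s = d,
      X.1 = -(euler f * (lead r s A w).1) ∧ X.2.1 = f * (lead r s A w).1 ∧
        ∀ i, euler (X.2.2 i - f * (lead r s A w).2 i) = 0 := by
  obtain ⟨h1, h2, -⟩ := mem_homGens.1 hX |>.imp_right mem_homFields.1
  have hfst : ∀ m j, cf m j X.1 + 2 * ((j : ℝ) - s) * cf m j X.2.1 = 0 := fun m j => by
    have := cf_act_lead_fst (s := s) A w X m j
    rw [h] at this
    simpa [hA] using this.symm
  have hsnd : ∀ i m j, w i * cf m (s + j) X.1 + 2 * A * j * cf m j (X.2.2 i) = 0 :=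
    fun i m j => by
      have := cf_act_lead_snd (s := s) A w X i m j
      rw [h] at this
      simpa using this.symm
  have hT : ∀ m, ∀ j ≤ s, cf m j X.1 = 0 := fun m j hj => by
    have := cf_act_lead_snd_of_le A w X e m hj
    rw [h] at this
    simpa [hw] using this.symm
  have hp : ∀ m, ∀ j < s, cf m j X.2.1 = 0 := fun m j hj => by
    have := hfst m j
    have hne : (j : ℝ) - s ≠ 0 := sub_ne_zero.2 (by exact_mod_cast hj.ne)
    rw [hT m j hj.le] at this
    simpa [hne] using this
  refine ⟨shiftScale s (fun _ => A⁻¹) X.2.1, fun m j hm => ?_, ext_cf fun m j => ?_,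
    ext_cf fun m j => ?_, fun i => ext_cf fun m j => ?_⟩
  · rw [cf_shiftScale, h2 m _ (by rw [weight_add_right]; exact hm), mul_zero]
  · rw [cf_neg, lead, show ∀ f : Ser r, f * (cst A * PowerSeries.X ^ s) =
      PowerSeries.X ^ s * (cst A * f) from fun f => by ring, cf_X_pow_mul]
    split_ifs with hj
    · obtain ⟨i, rfl⟩ := Nat.exists_eq_add_of_le' hj
      have := hfst m (i + s)
      simp only [Nat.add_sub_cancel, cf_cst_mul, cf_euler, cf_shiftScale]
      field_simp
      push_cast at this
      linarith
    · rw [hT m j (by omega), neg_zero]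
  · rw [lead, show ∀ f : Ser r, f * (cst A * PowerSeries.X ^ s) =
      PowerSeries.X ^ s * (cst A * f) from fun f => by ring, cf_X_pow_mul]
    split_ifs with hj
    · rw [cf_cst_mul, cf_shiftScale, Nat.sub_add_cancel hj]
      field_simp
    · exact hp m j (by omega)
  · rw [lead, mul_comm, cf_euler, cf_sub, cf_cst_mul, cf_shiftScale, cf_zero]
    have h4 := hsnd i m j
    have h5 := hfst m (j + s)
    rw [add_comm s j] at h4
    push_cast at h5
    have h6 : cf m (j + s) X.1 = -(2 * j * cf m (j + s) X.2.1) := by linarith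
    rw [h6] at h4
    field_simp
    linarith

/-- The sequence of homogeneous generators obtained from a homogeneous series `f` of weight
`d - s` and the components `v_l = h_l Ê₀ + …` of `v`: its term of grade `d - s + l` is
`(-(ρ ∂f/∂ρ) h_l, f v_l)`. -/
noncomputable def trivialGen (s d : ℕ) (f : Ser r) (v : LeafAlg k r) (i : ℕ) : Gen k r :=
  if d ≤ i + s then
    (-(euler f * (part s (i + s - d) v).1), (f * (part s (i + s - d) v).1,
      fun l => f * (part s (i + s - d) v).2 l))
  else 0

lemma trivialGen_mem_homGens {d : ℕ} {f : Ser r}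
    (hf : f ∈ supportedSer fun m j => weight s 0 m j + s = d) (v : LeafAlg k r) (i : ℕ) :
    trivialGen s d f v i ∈ homGens k r s i := by
  unfold trivialGen
  split_ifs with h
  · have hv := part_mem_homFields (s := s) (i + s - d) v
    have h1 : ∀ g ∈ supportedSer (fun m j => weight s 0 m j + s = d),
        g * (part s (i + s - d) v).1 ∈ supportedSer fun m j => weight s 0 m j = i :=
      fun g hg => mul_mem_supportedSer hg hv.1 fun m a m' b h1 h2 => by
        have : weight s 0 (m + m') (a + b) = _ := weight_add s 0 0 m m' a b
        omega
    refine ⟨neg_mem (h1 _ (euler_mem_supportedSer hf)), h1 _ hf, fun l _ => ?_⟩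
    refine mul_mem_supportedSer hf (hv.2 l trivial) fun m a m' b h1 h2 => ?_
    have := weight_add s 0 s m m' a b
    rw [zero_add] at this
    omega
  · exact zero_mem _

/-- The generators `(-(ρ ∂f/∂ρ) h, f v)` act on other components of the field antisymmetrically. -/
lemma act_multiple_antisymm (f : Ser r) (u v : LeafAlg k r) :
    act u (-(euler f * v.1), (f * v.1, fun l => f * v.2 l)) =
      -act v (-(euler f * u.1), (f * u.1, fun l => f * u.2 l)) := by
  rw [act_apply, act_apply]
  refine Prod.ext ?_ (funext fun i => ?_)
  · simp only [euler_mul, Prod.fst_neg]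
    ring
  · simp only [euler_mul, Prod.snd_neg, Pi.neg_apply]
    ring

lemma sum_antidiagonal_shift {M : Type*} [AddCommMonoid M] (e q : ℕ) (F : ℕ × ℕ → M)
    (hF : ∀ p, p.1 < e → F p = 0) :
    ∑ p ∈ Finset.HasAntidiagonal.antidiagonal (q + e), F p =
      ∑ p ∈ Finset.HasAntidiagonal.antidiagonal q, F (p.1 + e, p.2) := by
  induction e generalizing F with
  | zero => simp
  | succ e ih =>
    rw [← add_assoc, Finset.Nat.sum_antidiagonal_succ, hF _ (Nat.succ_pos e), zero_add,
      ih (fun p => F (p.1 + 1, p.2)) fun p hp => hF _ (Nat.succ_lt_succ hp)]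
    simp only [add_assoc]

lemma dMap_trivialGen {d : ℕ} {f : Ser r}
    (hf : f ∈ supportedSer fun m j => weight s 0 m j + s = d) (v : LeafAlg k r) (q : ℕ) :
    dMap s v q (trivialGen s d f v) = 0 := by
  rw [dMap_apply]
  rcases lt_or_ge d s with hd | hd
  · have h0 : f = 0 := ext_cf fun m j => by
      rw [cf_zero]
      exact hf m j (by omega)
    refine Finset.sum_eq_zero fun p _ => ?_
    have : trivialGen s d f v p.1 = 0 := by
      unfold trivialGen
      split_ifs
      · subst h0
        refine Prod.ext ?_ (Prod.ext ?_ (funext fun l => ?_)) <;> simp [euler_zero]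
      · rfl
    rw [this, map_zero]
  obtain ⟨e, rfl⟩ := Nat.exists_eq_add_of_le' hd
  have hlt : ∀ i < e, trivialGen s (e + s) f v i = 0 := fun i hi => if_neg (by omega)
  rcases lt_or_ge q e with hq | hq
  · refine Finset.sum_eq_zero fun p hp => ?_
    rw [Finset.HasAntidiagonal.mem_antidiagonal] at hp
    rw [hlt _ (by omega), map_zero]
  obtain ⟨q, rfl⟩ := Nat.exists_eq_add_of_le' hq
  rw [sum_antidiagonal_shift e q _ fun p hp => by rw [hlt _ hp, map_zero]]
  have hge : ∀ i, trivialGen s (e + s) f v (i + e) =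
      (-(euler f * (part s i v).1), (f * (part s i v).1, fun l => f * (part s i v).2 l)) :=
    fun i => by
      rw [trivialGen, if_pos (by omega), show i + e + s - (e + s) = i by omega]
  simp only [hge]
  -- The sum equals its opposite after exchanging the two indices.
  have : IsAddTorsionFree (LeafAlg k r) := IsAddTorsionFree.of_isTorsionFree ℝ _
  rw [← self_eq_neg, ← Finset.sum_neg_distrib, ← Finset.Nat.sum_antidiagonal_swap]
  exact Finset.sum_congr rfl fun p _ => act_multiple_antisymm f _ _

lemma act_eq_zero_of_euler_eq_zero (v : LeafAlg k r) {h : Fin k → Ser r}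
    (hh : ∀ i, euler (h i) = 0) : act v (0, (0, h)) = 0 := by
  rw [act_apply]
  refine Prod.ext ?_ (funext fun i => ?_) <;> simp [euler_zero, hh]

section Level

variable {v : LeafAlg k r} {A : ℝ} {w : Fin k → ℝ}

lemma dMap_of_vanishing (hlow : ∀ l < s, part s l v = 0) (hlead : part s s v = lead r s A w)
    {d : ℕ} {X : ℕ → Gen k r} (hX : ∀ i < d, X i = 0) :
    dMap s v (d + s) X = act (lead r s A w) (X d) := by
  rw [dMap_apply, Finset.sum_eq_single (d, s), hlead]
  · rintro ⟨i, l⟩ hp hne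
    rw [Finset.HasAntidiagonal.mem_antidiagonal] at hp
    simp only at hp ⊢
    rcases lt_trichotomy i d with h | h | h
    · rw [hX i h, map_zero]
    · exact absurd (Prod.ext h (by simp only; omega)) hne
    · rw [hlow l (by omega), act_zero_left]
  · intro h
    simp at h

/-- Every kernel element of the leading operator lifts to a sequence of generators annihilating
the whole field, so the lowest term of a generator can be removed without changing the image. -/
lemma exists_levelDomain_succ (hlow : ∀ l < s, part s l v = 0)
    (hlead : part s s v = lead r s A w) (hA : A ≠ 0) {e : Fin k} (hw : w e ≠ 0) {N d : ℕ}
    (hd : d + s < N) {X : ℕ → Gen k r} (hX : X ∈ levelDomain s v N N) (hXd : ∀ i < d, X i = 0) :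
    ∃ Y ∈ levelDomain s v N N, (∀ i < d + 1, Y i = 0) ∧ dMap s v N Y = dMap s v N X := by
  obtain ⟨hhom, -, hzero⟩ := hX
  have hker : act (lead r s A w) (X d) = 0 := by
    rw [← dMap_of_vanishing hlow hlead hXd]
    exact hzero _ hd
  obtain ⟨f, hf, hf1, hf2, hf3⟩ := exists_multiplier_of_act_lead_eq_zero hA hw (hhom d) hker
  let h : Fin k → Ser r := fun i => (X d).2.2 i - f * (lead r s A w).2 i
  let Z : ℕ → Gen k r := Pi.single d (0, (0, h))
  have hK : trivialGen s d f v d = X d - (0, (0, h)) := by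
    rw [trivialGen, if_pos (Nat.le_add_right d s), Nat.add_sub_cancel_left, hlead]
    refine Prod.ext ?_ (Prod.ext ?_ (funext fun i => ?_))
    · simp [hf1]
    · simp [hf2]
    · simp [h]
  have hdZ : ∀ q, dMap s v q Z = 0 := fun q => by
    rw [dMap_apply]
    refine Finset.sum_eq_zero fun p _ => ?_
    by_cases hp : p.1 = d
    · rw [hp, show Z d = (0, (0, h)) from Pi.single_eq_same _ _]
      exact act_eq_zero_of_euler_eq_zero _ hf3
    · rw [show Z p.1 = 0 from Pi.single_eq_of_ne hp _, map_zero]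
  have hdY : ∀ q, dMap s v q (X - trivialGen s d f v - Z) = dMap s v q X := fun q => by
    rw [map_sub, map_sub, dMap_trivialGen hf, hdZ, sub_zero, sub_zero]
  have hZmem : ∀ i, Z i ∈ homGens k r s i := fun i => by
    by_cases hi : i = d
    · subst hi
      have : Z i = X i - trivialGen s i f v i := by
        rw [hK, show Z i = (0, (0, h)) from Pi.single_eq_same _ _, sub_sub_cancel]
      rw [this]
      exact sub_mem (hhom i) (trivialGen_mem_homGens hf v i)
    · rw [show Z i = 0 from Pi.single_eq_of_ne hi _]
      exact zero_mem _
  have hYlow : ∀ i < d + 1, (X - trivialGen s d f v - Z) i = 0 := fun i hi => by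
    rw [Pi.sub_apply, Pi.sub_apply]
    rcases (Nat.lt_succ_iff.1 hi).lt_or_eq with hi | rfl
    · rw [hXd i hi, show Z i = 0 from Pi.single_eq_of_ne hi.ne _, trivialGen]
      split_ifs with hle
      · rw [hlow _ (by omega)]
        refine Prod.ext ?_ (Prod.ext ?_ (funext fun l => ?_)) <;> simp
      · simp
    · rw [hK, show Z i = (0, (0, h)) from Pi.single_eq_same _ _, sub_sub_cancel, sub_self]
  refine ⟨X - trivialGen s d f v - Z, ⟨fun i => ?_, fun i hi => ?_, fun q hq => ?_⟩, hYlow,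
    hdY N⟩
  · exact sub_mem (sub_mem (hhom i) (trivialGen_mem_homGens hf v i)) (hZmem i)
  · exact hYlow i (by omega)
  · rw [hdY]
    exact hzero q hq

lemma levelImage_of_le (hlow : ∀ l < s, part s l v = 0) {N : ℕ} (hN : N ≤ s) :
    levelImage s v N N = ⊥ := by
  rw [eq_bot_iff]
  rintro _ ⟨X, ⟨-, h0, -⟩, rfl⟩
  rw [Submodule.mem_bot, dMap_apply]
  refine Finset.sum_eq_zero fun p hp => ?_
  rw [Finset.HasAntidiagonal.mem_antidiagonal] at hp
  rcases Nat.eq_zero_or_pos p.1 with h | h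
  · rw [h0 p.1 (by omega), map_zero]
  · rw [hlow p.2 (by omega), act_zero_left]

/-- The terms removable with generators of all grades are those removable by the leading part of
the field. -/
lemma levelImage_eq_map (hlow : ∀ l < s, part s l v = 0) (hlead : part s s v = lead r s A w)
    (hA : A ≠ 0) {e : Fin k} (hw : w e ≠ 0) {d : ℕ} (hd : 0 < d) :
    levelImage s v (d + s) (d + s) = (homGens k r s d).map (act (lead r s A w)) := by
  apply le_antisymm
  · rintro _ ⟨X, hX, rfl⟩
    have : ∀ c ≤ d, ∃ Y ∈ levelDomain s v (d + s) (d + s), (∀ i < c, Y i = 0) ∧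
        dMap s v (d + s) Y = dMap s v (d + s) X := by
      intro c hc
      induction c with
      | zero => exact ⟨X, hX, fun i hi => absurd hi (Nat.not_lt_zero i), rfl⟩
      | succ c ih =>
        obtain ⟨Y, hY, hY0, hYX⟩ := ih (by omega)
        obtain ⟨Z, hZ, hZ0, hZY⟩ :=
          exists_levelDomain_succ hlow hlead hA hw (by omega) hY hY0
        exact ⟨Z, hZ, hZ0, hZY.trans hYX⟩
    obtain ⟨Y, hY, hY0, hYX⟩ := this d le_rfl
    rw [← hYX, dMap_of_vanishing hlow hlead hY0]
    exact ⟨Y d, hY.1 d, rfl⟩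
  · rintro _ ⟨Z, hZ, rfl⟩
    have hsingle : ∀ i ≠ d, (Pi.single d Z : ℕ → Gen k r) i = 0 := fun i hi =>
      Pi.single_eq_of_ne hi _
    have hsame : (Pi.single d Z : ℕ → Gen k r) d = Z := Pi.single_eq_same _ _
    refine ⟨Pi.single d Z, ⟨fun i => ?_, fun i hi => hsingle i (by omega), fun q hq => ?_⟩, ?_⟩
    · by_cases hi : i = d
      · subst hi
        rwa [hsame]
      · rw [hsingle i hi]
        exact zero_mem _
    · rw [dMap_apply]
      refine Finset.sum_eq_zero fun p hp => ?_
      rw [Finset.HasAntidiagonal.mem_antidiagonal] at hp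
      by_cases h : p.1 = d
      · rw [hlow p.2 (by omega), act_zero_left]
      · rw [hsingle _ h, map_zero]
    · rw [dMap_of_vanishing hlow hlead fun i hi => hsingle i hi.ne, hsame]

end Level

/-! ### The complement -/

lemma mem_remainingTerms {hk : 0 < k} {N : ℕ} {x : LeafAlg k r} :
    x ∈ remainingTerms r hk s N ↔ x ∈ homFields k r s N ∧
      (∀ m j, ¬ (j < s ∨ (j = s ∧ m = 0)) → cf m j x.1 = 0) ∧
      ∀ i m j, ¬ (if i = firstIdx hk then j = s ∨ (j = 0 ∧ m = 0) else j ≤ s) →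
        cf m j (x.2 i) = 0 :=
  Submodule.mem_inf.trans (and_congr_right fun _ => mem_supportedFields)

lemma remainingTerms_of_le (hk : 0 < k) {N : ℕ} (hN : N ≤ s) :
    remainingTerms r hk s N = homFields k r s N := by
  refine inf_eq_left.2 fun x hx => ?_
  obtain ⟨h1, h2⟩ := mem_homFields.1 hx
  refine mem_supportedFields.2 ⟨fun m j hP => h1 m j fun hw => hP ?_,
    fun i m j hQ => h2 i m j fun hw => hQ ?_⟩
  · obtain ⟨rfl, hj⟩ := weight_lt_succ_iff.1 (show weight s 0 m j < s + 1 by omega)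
    simpa using hj.lt_or_eq
  · rw [weight_eq_add] at hw
    obtain ⟨rfl, -⟩ := weight_lt_succ_iff.1 (show weight s 0 m j < s + 1 by omega)
    rw [weight_zero_zero] at hw
    obtain rfl : j = 0 := by omega
    simp

lemma map_act_lead_inf_remainingTerms (hk : 0 < k) {A : ℝ} (hA : A ≠ 0) {w : Fin k → ℝ}
    (hw : w (firstIdx hk) ≠ 0) {d : ℕ} (hd : 0 < d) :
    (homGens k r s d).map (act (lead r s A w)) ⊓ remainingTerms r hk s (d + s) = ⊥ := by
  rw [eq_bot_iff]
  rintro x ⟨⟨X, hX, rfl⟩, hrem⟩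
  obtain ⟨hhom, h1, h2⟩ := mem_remainingTerms.1 hrem
  obtain ⟨g1, g2⟩ := mem_homFields.1 hhom
  have hfst : ∀ m j, cf m j (act (lead r s A w) X).1 = 0 := fun m j => by
    rcases lt_or_ge j s with h | h
    · exact cf_act_lead_fst_of_lt A w X m h
    · by_cases h0 : j = s ∧ m = 0
      · obtain ⟨rfl, rfl⟩ := h0
        exact g1 0 j (by rw [weight_zero_zero]; omega)
      · exact h1 m j (by rintro (h' | h'); exacts [absurd h h'.not_ge, h0 h'])
  have hT : ∀ m, ∀ j ≤ s, cf m j X.1 = 0 := fun m j hj => by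
    rcases hj.lt_or_eq with h | rfl
    · have h3 := cf_act_lead_snd_of_le A w X (firstIdx hk) m hj
      have h4 : cf m j ((act (lead r s A w) X).2 (firstIdx hk)) = 0 := by
        by_cases h0 : j = 0 ∧ m = 0
        · obtain ⟨rfl, rfl⟩ := h0
          exact g2 _ 0 0 (by rw [weight_zero_zero]; omega)
        · exact h2 _ m j (by rw [if_pos rfl]; rintro (h' | h'); exacts [h.ne h', h0 h'])
      rw [h4] at h3
      simpa [hw] using h3.symm
    · have h3 := cf_act_lead_fst (s := j) A w X m j
      rw [hfst, sub_self, mul_zero, zero_mul, add_zero] at h3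
      simpa [hA] using h3.symm
  rw [Submodule.mem_bot]
  refine ext_field (fun m j => by rw [hfst]; simp) fun i m j => ?_
  change _ = cf m j 0
  rw [cf_zero]
  rcases le_or_gt j s with h | h
  · rw [cf_act_lead_snd_of_le A w X i m h, hT m j h, mul_zero]
  · refine h2 i m j ?_
    split_ifs
    · rintro (h' | h')
      exacts [h.ne' h', by omega]
    · omega

lemma map_act_lead_sup_remainingTerms (hk : 0 < k) {A : ℝ} (hA : A ≠ 0) {w : Fin k → ℝ}
    (hw : w (firstIdx hk) ≠ 0) {d : ℕ} :
    (homGens k r s d).map (act (lead r s A w)) ⊔ remainingTerms r hk s (d + s) =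
      homFields k r s (d + s) := by
  refine le_antisymm (sup_le ?_ inf_le_left) fun x hx => ?_
  · rintro _ ⟨X, hX, rfl⟩
    exact act_lead_mem_homFields A w hX
  set e := firstIdx hk with he
  obtain ⟨h1, h2⟩ := mem_homFields.1 hx
  -- The time rescaling removes the first rotation off the power `s`, and at the power `s` the
  -- Eulerian term of degree `2 s`, which state transformations cannot reach.
  let T : (Fin r →₀ ℕ) → ℕ → ℝ := fun m j =>
    if j = s then A⁻¹ * cf m (s + s) x.1 else (w e)⁻¹ * cf m j (x.2 e)
  let p : (Fin r →₀ ℕ) → ℕ → ℝ := fun m j =>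
    if j = s then 0 else (A⁻¹ * cf m (s + j) x.1 - T m j) / (2 * ((j : ℝ) - s))
  let h : Fin k → (Fin r →₀ ℕ) → ℕ → ℝ := fun i m j =>
    if j = 0 then 0 else (cf m (s + j) (x.2 i) - w i * T m (s + j)) / (2 * A * j)
  let X : Gen k r := (ofCf T, (ofCf p, fun i => ofCf (h i)))
  have hT : ∀ m j, weight s 0 m j ≠ d → T m j = 0 := fun m j hj => by
    simp only [T]
    split_ifs with hjs
    · subst hjs
      rw [h1 m _ (by rw [weight_add_right]; omega), mul_zero]
    · rw [h2 e m j (by rw [weight_eq_add]; omega), mul_zero]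
  have hX : X ∈ homGens k r s d := by
    refine mem_homGens.2 ⟨fun m j hj => by rw [cf_ofCf, hT m j hj], mem_homFields.2
      ⟨fun m j hj => ?_, fun i m j hj => ?_⟩⟩
    · simp only [X, cf_ofCf, p]
      rw [hT m j hj, add_comm s j, h1 m _ (by rw [weight_add_right]; omega)]
      simp
    · rw [weight_eq_add] at hj
      simp only [X, cf_ofCf, h]
      rw [add_comm s j, hT m _ (by rw [weight_add_right]; omega),
        h2 i m _ (by rw [weight_add_right, weight_eq_add]; omega)]
      simp
  refine Submodule.mem_sup.2 ⟨act (lead r s A w) X, ⟨X, hX, rfl⟩, x - act (lead r s A w) X,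
    mem_remainingTerms.2 ⟨sub_mem hx (act_lead_mem_homFields A w hX), fun m j hP => ?_,
      fun i m j hQ => ?_⟩, add_sub_cancel _ _⟩
  · obtain ⟨i, rfl⟩ := Nat.exists_eq_add_of_le (show s ≤ j by omega)
    rw [Prod.fst_sub, cf_sub, cf_act_lead_fst]
    simp only [X, cf_ofCf, p]
    by_cases hi : i = s
    · subst hi
      simp only [T, if_true]
      field_simp
      ring
    · have hne : (i : ℝ) - s ≠ 0 := sub_ne_zero.2 (by exact_mod_cast hi)
      rw [if_neg hi]
      field_simp
      ring
  · rw [Prod.snd_sub, Pi.sub_apply, cf_sub]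
    have hhigh : s < j → cf m j (x.2 i) - cf m j ((act (lead r s A w) X).2 i) = 0 := by
      intro hj
      obtain ⟨l, rfl⟩ := Nat.exists_eq_add_of_le hj.le
      have hl : l ≠ 0 := by omega
      have hl' : (l : ℝ) ≠ 0 := by exact_mod_cast hl
      rw [cf_act_lead_snd]
      simp only [X, cf_ofCf, h, if_neg hl]
      field_simp
      ring
    split_ifs at hQ with hi
    · rcases le_or_gt j s with hj | hj
      · have hjs : j ≠ s := fun h' => hQ (Or.inl h')
        rw [cf_act_lead_snd_of_le A w X i m hj, hi]
        simp only [X, cf_ofCf, T, if_neg hjs]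
        field_simp
        ring
      · exact hhigh hj
    · exact hhigh (by omega)

/-- A finite parametric field in normalised form is an infinite-level normal form. -/
theorem isInfiniteLevel_finiteField (hk : 0 < k) (hkn : k ≤ n)
    (σ : Equiv.Perm (Fin n)) (ω : Fin n → ℝ) (hω : ∀ i, ω i ≠ 0) (a : ℕ → Param r)
    (b : Fin k → ℕ → Param r) (hs : 0 < s) {A : ℝ} (hA : A ≠ 0)
    (ha : ∀ j < s, atZero (a j) = 0) (hb : ∀ i, atZero (b i 0) = 0)
    (hb1 : ∀ j < s, b (firstIdx hk) j = 0) (has : a s = MvPowerSeries.C A) :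
    IsInfiniteLevel s (remainingTerms r hk s) (finiteField hkn σ ω s a b) := by
  set v := finiteField hkn σ ω s a b with hv
  let w : Fin k → ℝ := fun i => ω (sel hkn σ i)
  have h1 : ∀ m j, cf m j v.1 = if j ≤ s then MvPowerSeries.coeff m (a j) else 0 := fun m j =>
    cf_sum_range m j s a
  have h2 : ∀ i m j, cf m j (v.2 i) = (if m = 0 ∧ j = 0 then w i else 0) +
      if j ≤ s then MvPowerSeries.coeff m (b i j) else 0 := fun i m j => by
    rw [← cf_sum_range m j s (b i), ← cf_cst]
    exact cf_add m j _ _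
  have h10 : ∀ j < s, cf 0 j v.1 = 0 := fun j hj => by
    rw [h1, if_pos hj.le, ← atZero_eq_coeff, ha j hj]
  have hlow : ∀ l < s, part s l v = 0 := fun l hl => by
    refine ext_field (fun m j => ?_) fun i m j => ?_
    · rw [cf_part_fst]
      split_ifs with hwt
      · obtain ⟨rfl, -⟩ := weight_lt_succ_iff.1 (show weight s 0 m j < s + 1 by omega)
        rw [weight_zero_zero] at hwt
        rw [h10 j (by omega)]
        simp
      · simp
    · rw [cf_part_snd, if_neg (by rw [weight_eq_add]; omega)]
      exact (cf_zero m j).symm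
  have hlead : part s s v = lead r s A w := by
    refine ext_field (fun m j => ?_) fun i m j => ?_
    · rw [cf_part_fst, lead, mul_comm, cf_X_pow_mul, cf_cst]
      by_cases h : m = 0 ∧ j = s
      · obtain ⟨rfl, rfl⟩ := h
        rw [weight_zero_zero, if_pos (zero_add j), h1, has]
        simp
      · rw [if_neg fun hwt => h ?_]
        · by_cases hj : s ≤ j
          · rw [if_pos hj, if_neg fun h' => h ⟨h'.1, by omega⟩]
          · rw [if_neg hj]
        · obtain ⟨rfl, -⟩ := weight_lt_succ_iff.1 (show weight s 0 m j < s + 1 by omega)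
          rw [weight_zero_zero] at hwt
          exact ⟨rfl, by omega⟩
    · rw [cf_part_snd]
      change _ = cf m j (cst (w i))
      rw [cf_cst]
      by_cases h : m = 0 ∧ j = 0
      · obtain ⟨rfl, rfl⟩ := h
        rw [weight_zero_zero, if_pos (add_zero s), h2, ← atZero_eq_coeff, hb]
        simp
      · rw [if_neg h, if_neg fun hwt => h ?_]
        rw [weight_eq_add] at hwt
        obtain ⟨rfl, -⟩ := weight_lt_succ_iff.1 (show weight s 0 m j < s + 1 by omega)
        rw [weight_zero_zero] at hwt
        exact ⟨rfl, by omega⟩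
  have hpart : ∀ N, part s N v ∈ remainingTerms r hk s N := fun N => by
    refine mem_remainingTerms.2 ⟨part_mem_homFields N v, fun m j hP => ?_, fun i m j hQ => ?_⟩
    · have : cf m j v.1 = 0 := by
        rw [h1]
        split_ifs with hj
        · obtain rfl : j = s := by omega
          rw [has, MvPowerSeries.coeff_C, if_neg fun hm => hP (Or.inr ⟨rfl, hm⟩)]
        · rfl
      simp [this]
    · have : cf m j (v.2 i) = 0 := by
        rw [h2]
        split_ifs at hQ with hi
        · rw [if_neg fun h' => hQ (Or.inr h'.symm), zero_add]
          split_ifs with hj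
          · rw [hi, hb1 j (lt_of_le_of_ne hj fun h' => hQ (Or.inl h')), map_zero]
          · rfl
        · rw [if_neg hQ, if_neg fun h' => hQ (by omega), add_zero]
      simp [this]
  have hwe : w (firstIdx hk) ≠ 0 := hω _
  intro N
  rcases le_or_gt N s with hN | hN
  · rw [levelImage_of_le hlow hN, remainingTerms_of_le hk hN]
    exact ⟨bot_inf_eq _, bot_sup_eq _, part_mem_homFields N v⟩
  · obtain ⟨d, rfl⟩ := Nat.exists_eq_add_of_le' hN.le
    have hd : 0 < d := by omega
    rw [levelImage_eq_map hlow hlead hA hwe hd]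
    exact ⟨map_act_lead_inf_remainingTerms hk hA hwe hd, map_act_lead_sup_remainingTerms hk hA hwe,
      hpart _⟩

end LeafNF

theorem mainTheorem4 (n k r : ℕ) (hk : 0 < k) (hkn : k ≤ n)
    (σ : Equiv.Perm (Fin n)) (hσ : σ ∈ cellPerms n k)
    (C : Fin n → ℝ) (hC : C ∈ leafLabels n k σ)
    (ω : Fin n → ℝ) (hω : ∀ i, ω i ≠ 0)
    (a : ℕ → Param r) (b : Fin k → ℕ → Param r)
    (ha : atZero (a 0) = 0) (hb : ∀ i, atZero (b i 0) = 0)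
    (s : ℕ) (hs : IsLeast {j | atZero (a j) ≠ 0} s) :
    ∃ (T φ : Ser r) (ψ : Fin k → Ser r) (a' : ℕ → Param r) (b' : Fin k → ℕ → Param r),
      value00 T = 0 ∧ value00 φ = 0 ∧ (∀ i, value00 (ψ i) = 0) ∧
      Transforms hk (leafChange hk hkn σ C φ ψ)
        (timeRescale T (toField hk hkn σ C (parametricField hkn σ ω a b)))
        (toField hk hkn σ C (finiteField hkn σ ω s a' b')) ∧
      (∀ j < s, atZero (a' j) = 0) ∧
      (∀ i, atZero (b' i 0) = 0) ∧
      (∀ j < s, b' (firstIdx hk) j = 0) ∧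
      a' s = MvPowerSeries.C (atZero (a s)) ∧
      IsInfiniteLevel s (remainingTerms r hk s) (finiteField hkn σ ω s a' b') := by
  have hs0 : 0 < s := Nat.pos_of_ne_zero fun h => hs.1 (h ▸ ha)
  obtain ⟨T, φ, ψ, a', b', hT, hφ, hψ, htr, ha', hb', hb1, has⟩ :=
    exists_finite_normalForm hk hkn σ C hC ω hω a b ha hb s hs
  exact ⟨T, φ, ψ, a', b', hT, hφ, hψ, htr, ha', hb', hb1, has,
    isInfiniteLevel_finiteField hk hkn σ ω hω a' b' hs0 hs.1 ha' hb' hb1 has⟩
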